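/- Let $1\le b\le d$ be integers, and consider on the torus $\mathbb T^d=(\mathbb R/2\pi\mathbb Z)^d$ the quasi-linear Schrödinger equation $$i u_t-\Delta u+\rho u+\Delta\Big(\frac{\partial H}{\partial\bar u}(u,\bar u)\Big)=0,\qquad H(u,\bar u)=|u|^4+\sum_{l+l'\ge 5}\alpha_{l,l'}u^l\bar u^{l'},\qquad(1)$$ where $\alpha_{l,l'}=\alpha_{l',l}\in\mathbb R$ and the power series $H$ is analytic near $0$. Assume that $\rho\in\mathbb R$ is Diophantine: for some $\gamma>0$, $\tau>1$, $$|m\rho-l|\ge\frac{\gamma}{|m|^{\tau}}\qquad\text{for all } m\in\mathbb Z\setminus\{0\},\ l\in\mathbb Z.$$ Let $n_1,\dots,n_b\in\mathbb Z^d$ be linearly independent, and suppose that the unit vectors $e_1,\dots,e_b$ are the only $k\in\mathbb Z^b$ with $\sum_j k_j=1$ and $\sum_j k_j|n_j|^2=\big|\sum_j k_jn_j\big|^2$ (that is, $\mathcal K_2(n_1,\dots,n_b)=\emptyset$). Put $\omega_0=(|n_1|^2+\rho,\dots,|n_b|^2+\rho)$. Then there is $\kappa>0$ such that for all $\sigma>0$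 and $s>b/2$ there are constants $C>0$ and $\varepsilon_0>0$ with the following property. For every $0<\varepsilon<\varepsilon_0$ and every $a=(a_1,\dots,a_b)\in[\varepsilon,2\varepsilon]^b$, the solution $\sum_j a_je^{in_j\cdot x+i(|n_j|^2+\rho)t}$ of the linear equation $iu_t-\Delta u+\rho u=0$ persists: there are a frequency vector $\omega\in\mathbb R^b$ and a classical solution of (1), defined for all $t\in\mathbb R$, of the form $$u(x,t)=\sum_{n\in\mathbb Z^d,\,k\in\mathbb Z^b}\hat u(n,k)e^{in\cdot x+ik\cdot\omega t},$$ such that $\hat u(n_j,e_j)=a_j$ for $1\le j\le b$, $$\Big(\sum_{(n,k)\notin\{(n_j,e_j)\}}|\hat u(n,k)|^2|(n,k)|^{2s}e^{2\sigma|(n,k)|}\Big)^{1/2}<|a|^{1+\kappa},\qquad |\omega-\omega_0|\le C|a|^2,$$ and $$\Big|\omega_j-|n_j|^2-\rho+|n_j|^2\Big(4\sum_{l=1}^b a_l^2-2a_j^2\Big)\Big|\le C|a|^3,\qquad j=1,\dots,b.$$ Here $|\cdot|$ is the Euclidean norm. -/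

import Mathlib

noncomputable section

namespace QuasilinearNLS

/-- The squared Euclidean length `|m|²` of an integer vector. -/
def sqNorm {r : ℕ} (m : Fin r → ℤ) : ℤ := ∑ i, m i ^ 2

/-- An integer vector, seen as a point of Euclidean space. -/
def toVec {r : ℕ} (m : Fin r → ℤ) : EuclideanSpace ℝ (Fin r) :=
  WithLp.toLp 2 (fun i => (m i : ℝ))

/-- `ρ` is Diophantine with constants `γ, τ`: `|m ρ - l| ≥ γ / |m|^τ` for all integers
`m ≠ 0` and `l`. -/
def IsDiophantine (ρ γ τ : ℝ) : Prop :=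
  ∀ m : ℤ, m ≠ 0 → ∀ l : ℤ, γ / |(m : ℝ)| ^ τ ≤ |(m : ℝ) * ρ - (l : ℝ)|

/-- The resonant modes of `n₁, …, n_b ∈ ℤ^d`: all `k ∈ ℤ^b` with `∑ k_j = 1` and
`∑ k_j |n_j|² = |∑ k_j n_j|²`. -/
def resonantModes {b d : ℕ} (n : Fin b → Fin d → ℤ) : Set (Fin b → ℤ) :=
  {k | ∑ j, k j = 1 ∧ ∑ j, k j * sqNorm (n j) = sqNorm (∑ j, k j • n j)}

/-- The nontrivial resonant modes: the resonant modes other than the unit vectors `e_j`. -/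
def nontrivialResonantModes {b d : ℕ} (n : Fin b → Fin d → ℤ) : Set (Fin b → ℤ) :=
  resonantModes n \ Set.range (fun j : Fin b => (Pi.single j 1 : Fin b → ℤ))

/-- The series `∑ α_{l,l'} z^l w^{l'}` converges absolutely on the closed polydisc of radius `r`. -/
def ConvergesOn (α : ℕ → ℕ → ℝ) (r : ℝ) : Prop :=
  Summable (fun p : ℕ × ℕ => |α p.1 p.2| * r ^ (p.1 + p.2))

/-- The coefficients allowed in `H`: real, symmetric, only of total degree at least five, and
such that `H` is analytic near `0`. -/
structure IsAdmissible (α : ℕ → ℕ → ℝ) : Prop where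
  order_ge_five : ∀ l l', l + l' < 5 → α l l' = 0
  symm : ∀ l l', α l l' = α l' l
  analytic : ∃ r : ℝ, 0 < r ∧ ConvergesOn α r

/-- `H(z, w) = z² w² + ∑ α_{l,l'} z^l w^{l'}`, as a function of two independent complex
variables; `H(u, ū) = |u|⁴ + ∑ α_{l,l'} u^l ū^{l'}` is its value at `z = u`, `w = ū`. -/
def hamiltonian (α : ℕ → ℕ → ℝ) (z w : ℂ) : ℂ :=
  z ^ 2 * w ^ 2 + ∑' p : ℕ × ℕ, (α p.1 p.2 : ℂ) * z ^ p.1 * w ^ p.2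

/-- `∂H/∂ū (u, ū)`: the partial derivative in the second variable, at `(u, ū)`. -/
def dHbar (α : ℕ → ℕ → ℝ) (u : ℂ) : ℂ :=
  deriv (fun w : ℂ => hamiltonian α u w) (starRingEnd ℂ u)

/-- `u(t, x)` is a classical solution of `i u_t - Δu + ρ u + Δ(∂H/∂ū(u, ū)) = 0` for all times
`t ∈ ℝ` on the torus `(ℝ/2πℤ)^d`: it is `2π`-periodic in every coordinate of `x`, of class `C²`,
takes its values inside the region where the power series of `H` converges, and satisfies the
equation at every point. -/
structure IsSolution {d : ℕ} (α : ℕ → ℕ → ℝ) (ρ : ℝ)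
    (u : ℝ → EuclideanSpace ℝ (Fin d) → ℂ) : Prop where
  periodic : ∀ t x, ∀ i : Fin d, u t (x + EuclideanSpace.single i (2 * Real.pi)) = u t x
  contDiff : ContDiff ℝ 2 (fun p : ℝ × EuclideanSpace ℝ (Fin d) => u p.1 p.2)
  mem_domain : ∃ r : ℝ, ConvergesOn α r ∧ ∀ t x, ‖u t x‖ < r
  equation : ∀ t x,
    Complex.I * deriv (fun s => u s x) t - Laplacian.laplacian (u t) x + (ρ : ℂ) * u t x
      + Laplacian.laplacian (fun y => dHbar α (u t y)) x = 0

/-- The frequencies `ω_{n_j} = |n_j|² + ρ` of the linear equation. -/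
def linearFrequency {b d : ℕ} (n : Fin b → Fin d → ℤ) (ρ : ℝ) : EuclideanSpace ℝ (Fin b) :=
  WithLp.toLp 2 (fun j => (sqNorm (n j) : ℝ) + ρ)

/-- The exponential `exp(i n·x + i (k·ω) t)`. -/
def mode {b d : ℕ} (ω : EuclideanSpace ℝ (Fin b)) (n : Fin d → ℤ) (k : Fin b → ℤ)
    (t : ℝ) (x : EuclideanSpace ℝ (Fin d)) : ℂ :=
  Complex.exp (Complex.I *
    (((∑ i, (n i : ℝ) * x i) + (∑ j, (k j : ℝ) * ω j) * t : ℝ) : ℂ))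

/-- The Euclidean length `|(n, k)|` of `(n, k) ∈ ℤ^d × ℤ^b`. -/
def idxNorm {b d : ℕ} (p : (Fin d → ℤ) × (Fin b → ℤ)) : ℝ :=
  Real.sqrt ((sqNorm p.1 : ℝ) + (sqNorm p.2 : ℝ))

open Classical in
/-- The summand `|û(n,k)|² |(n,k)|^{2s} e^{2σ|(n,k)|}` for `(n,k)` different from all the
`(n_j, e_j)`, and `0` at these `b` indices. -/
def remainderTerm {b d : ℕ} (n : Fin b → Fin d → ℤ) (σ s : ℝ)
    (c : (Fin d → ℤ) × (Fin b → ℤ) → ℂ) (p : (Fin d → ℤ) × (Fin b → ℤ)) : ℝ :=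
  if ∃ j, p = (n j, Pi.single j 1) then 0
  else ‖c p‖ ^ 2 * idxNorm p ^ (2 * s) * Real.exp (2 * σ * idxNorm p)

/-- The linear solution `∑ a_j exp(i n_j·x + i ω_{n_j} t)` persists with frequency `ω`: there is
a solution `u = ∑ û(n,k) exp(i n·x + i (k·ω) t)` of the quasi-linear equation with
`û(n_j, e_j) = a_j`, with the remaining coefficients of weighted norm less than `|a|^{1+κ}`, and
with `|ω - ω₀| ≤ C |a|²`. -/
def PersistsWith {b d : ℕ} (α : ℕ → ℕ → ℝ) (ρ : ℝ) (n : Fin b → Fin d → ℤ)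
    (κ σ s C : ℝ) (a ω : EuclideanSpace ℝ (Fin b)) : Prop :=
  ∃ (u : ℝ → EuclideanSpace ℝ (Fin d) → ℂ) (c : (Fin d → ℤ) × (Fin b → ℤ) → ℂ),
    IsSolution α ρ u ∧
    (∀ t x, HasSum (fun p => c p * mode ω p.1 p.2 t x) (u t x)) ∧
    (∀ j, c (n j, Pi.single j 1) = (a j : ℂ)) ∧
    Summable (remainderTerm n σ s c) ∧
    Real.sqrt (∑' p, remainderTerm n σ s c p) < ‖a‖ ^ (1 + κ) ∧
    ‖ω - linearFrequency n ρ‖ ≤ C * ‖a‖ ^ 2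

end QuasilinearNLS

end

/-! The ansatz is restricted to the modes `(∑ k_j n_j, k)`, a set stable under products and
conjugation. All coefficients are taken real, so a solution is a real function on `ℤ^b`. With `w = ∑
k_j n_j` and `F` the coefficients of `∂H/∂ū`, the equation becomes `(|w|² + ρ - k·ω) û(k) = |w|²
F(k)` for each `k`.

On these modes there are no small divisors. Linear independence makes `|w|²` a positive definite
quadratic form in `k`, so `D(k) = |w|² + ρ - k·ω₀` is comparable to `|k|²` outside a finite set. On
that finite set the Diophantine and nonresonance conditions give `D(k) ≠ 0` unless `k` is a unit
vector (`divisor_ne_zero`). Hence `|w|²/D(k)` and `k_j/D(k)` are bounded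
(`exists_bound_div_divisor`): dividing by `D` recovers the two derivatives lost in the nonlinearity,
and a plain contraction suffices.

Write `u = u₀ + v` with `u₀` the linear solution and `v` vanishing at every `e_j`. The equation at
`e_j` determines the frequency shift `δ_j = -|n_j|² F(e_j)/a_j`. The other equations become the
fixed point equation `v(k) = (|w|²/D) F(k) + ∑ δ_j (k_j/D) v(k)`. It is solved in `ℓ¹` with weight
`exp(M|k|₁)`, a Banach algebra in which the power series of `H` converges on small elements
(`exists_small_solution`). Since `F = O(ε³)` and `a_j ≥ ε`, the shift is `O(ε²)`, the map contracts
the ball of radius `ε`, and `v = O(ε³)`.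

Evaluation at a space-time point is an algebra homomorphism turning `k ↦ -k` into complex
conjugation, so the coefficient equations give a classical solution (`isSolution_synth`). The
frequency expansion follows from `F = 2 u₀² ū₀ + O(ε⁴)` and the explicit cubic coefficient
(`coeff_cubic_linearPart`). -/

noncomputable section

namespace QuasilinearNLS

/-! ### The weighted `ℓ¹` convolution algebra. -/

/-- A symmetric submultiplicative weight on an additive group. -/
structure Weight (G : Type*) [AddCommGroup G] where
  toFun : G → ℝ
  one_le : ∀ k, 1 ≤ toFun k
  map_zero : toFun 0 = 1
  map_add_le : ∀ k l, toFun (k + l) ≤ toFun k * toFun l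
  map_neg : ∀ k, toFun (-k) = toFun k

instance {G : Type*} [AddCommGroup G] : CoeFun (Weight G) (fun _ => G → ℝ) := ⟨Weight.toFun⟩

/-- The weighted `ℓ¹` space of real functions on `G`; the value of an element at `k` is its
coefficient at `k` times the weight of `k`. -/
def WeightedL1 {G : Type*} [AddCommGroup G] (_W : Weight G) : Type _ := lp (fun _ : G => ℝ) 1

namespace WeightedL1

theorem weight_pos {G : Type*} [AddCommGroup G] (W : Weight G) (k : G) : 0 < W k :=
  lt_of_lt_of_le one_pos (W.one_le k)

variable {G : Type*} [AddCommGroup G] {W : Weight G}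

instance : NormedAddCommGroup (WeightedL1 W) :=
  inferInstanceAs (NormedAddCommGroup (lp (fun _ : G => ℝ) 1))

instance : NormedSpace ℝ (WeightedL1 W) :=
  inferInstanceAs (NormedSpace ℝ (lp (fun _ : G => ℝ) 1))

instance : CompleteSpace (WeightedL1 W) :=
  inferInstanceAs (CompleteSpace (lp (fun _ : G => ℝ) 1))

/-- An element, seen in the unweighted space of its weighted coefficients. -/
def toLp (u : WeightedL1 W) : lp (fun _ : G => ℝ) 1 := u

/-- The coefficient of an element at `k`. -/
def coeff (u : WeightedL1 W) (k : G) : ℝ := toLp u k / W k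

theorem coeff_add (u v : WeightedL1 W) (k : G) : coeff (u + v) k = coeff u k + coeff v k :=
  add_div _ _ _

theorem coeff_sub (u v : WeightedL1 W) (k : G) : coeff (u - v) k = coeff u k - coeff v k :=
  sub_div _ _ _

theorem coeff_smul (c : ℝ) (u : WeightedL1 W) (k : G) : coeff (c • u) k = c * coeff u k :=
  mul_div_assoc _ _ _

theorem coeff_zero (k : G) : coeff (0 : WeightedL1 W) k = 0 :=
  zero_div _

theorem coeff_sum {ι : Type*} (s : Finset ι) (f : ι → WeightedL1 W) (k : G) :
    coeff (∑ i ∈ s, f i) k = ∑ i ∈ s, coeff (f i) k := by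
  classical
  induction s using Finset.induction_on with
  | empty => simp [coeff_zero]
  | insert a s ha ih => rw [Finset.sum_insert ha, Finset.sum_insert ha, coeff_add, ih]

theorem hasSum_norm (u : WeightedL1 W) : HasSum (fun k => |coeff u k| * W k) ‖u‖ := by
  have h := lp.hasSum_norm (p := 1) (by simp) (toLp u)
  simp only [ENNReal.toReal_one, Real.rpow_one] at h
  have he : (fun k => |coeff u k| * W k) = fun k => ‖toLp u k‖ := funext fun k => by
    rw [coeff, abs_div, abs_of_pos (weight_pos W k), div_mul_cancel₀ _ (weight_pos W k).ne',
      Real.norm_eq_abs]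
  rw [he]
  exact h

theorem abs_coeff_mul_le (u : WeightedL1 W) (k : G) : |coeff u k| * W k ≤ ‖u‖ :=
  le_hasSum (hasSum_norm u) k fun j _ => mul_nonneg (abs_nonneg _) (weight_pos W j).le

theorem abs_coeff_le (u : WeightedL1 W) (k : G) : |coeff u k| ≤ ‖u‖ :=
  (le_mul_of_one_le_right (abs_nonneg _) (W.one_le k)).trans (abs_coeff_mul_le u k)

section Lift

variable {B : Type*} [NormedAddCommGroup B] [NormedSpace ℝ B]

theorem summable_coeff_smul {x : G → B} {C : ℝ} (hx : ∀ k, ‖x k‖ ≤ C * W k)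
    (u : WeightedL1 W) : Summable (fun k => ‖coeff u k • x k‖) := by
  refine Summable.of_nonneg_of_le (fun _ => norm_nonneg _) (fun k => ?_)
    ((hasSum_norm u).summable.mul_left C)
  rw [norm_smul, Real.norm_eq_abs]
  calc |coeff u k| * ‖x k‖ ≤ |coeff u k| * (C * W k) :=
        mul_le_mul_of_nonneg_left (hx k) (abs_nonneg _)
    _ = C * (|coeff u k| * W k) := by ring

variable [CompleteSpace B]

/-- The continuous linear map with prescribed values of controlled growth at the monomials. -/
def lift (x : G → B) (C : ℝ) (hx : ∀ k, ‖x k‖ ≤ C * W k) : WeightedL1 W →L[ℝ] B :=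
  LinearMap.mkContinuous
    { toFun := fun u => ∑' k, coeff u k • x k
      map_add' := fun u v => by
        rw [← (summable_coeff_smul hx u).of_norm.tsum_add (summable_coeff_smul hx v).of_norm]
        simp only [coeff_add, add_smul]
      map_smul' := fun c u => by
        simp only [coeff_smul, mul_smul, RingHom.id_apply]
        exact (summable_coeff_smul hx u).of_norm.tsum_const_smul c } C (fun u => by
      refine tsum_of_norm_bounded ((hasSum_norm u).mul_left C) fun k => ?_
      rw [norm_smul, Real.norm_eq_abs]
      calc |coeff u k| * ‖x k‖ ≤ |coeff u k| * (C * W k) :=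
            mul_le_mul_of_nonneg_left (hx k) (abs_nonneg _)
        _ = C * (|coeff u k| * W k) := by ring)

theorem hasSum_lift {x : G → B} {C : ℝ} (hx : ∀ k, ‖x k‖ ≤ C * W k) (u : WeightedL1 W) :
    HasSum (fun k => coeff u k • x k) (lift x C hx u) :=
  (summable_coeff_smul hx u).of_norm.hasSum

theorem norm_lift_le {x : G → B} {C : ℝ} (hC : 0 ≤ C) (hx : ∀ k, ‖x k‖ ≤ C * W k) :
    ‖lift x C hx‖ ≤ C :=
  LinearMap.mkContinuous_norm_le _ hC _

end Lift

variable [DecidableEq G]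

/-- The monomial with coefficient one at `k`. -/
def X (k : G) : WeightedL1 W := lp.single (E := fun _ : G => ℝ) 1 k (W k)

theorem coeff_X (k l : G) : coeff (X k : WeightedL1 W) l = if l = k then 1 else 0 := by
  by_cases h : l = k
  · subst h
    rw [if_pos rfl, ← div_self (weight_pos W l).ne']
    exact congrArg (· / W l) (lp.single_apply_self (E := fun _ : G => ℝ) 1 l (W l))
  · rw [if_neg h, ← zero_div (W l)]
    exact congrArg (· / W l) (lp.single_apply_ne (E := fun _ : G => ℝ) 1 k (W k) h)

theorem norm_X (k : G) : ‖(X k : WeightedL1 W)‖ = W k := by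
  have h := lp.norm_single (E := fun _ : G => ℝ) (p := 1) (by simp) k (W k)
  rw [Real.norm_of_nonneg (weight_pos W k).le] at h
  exact h

theorem hasSum_coeff_smul_X (u : WeightedL1 W) : HasSum (fun k => coeff u k • X k) u := by
  have h := lp.hasSum_single (E := fun _ : G => ℝ) (p := 1) (by simp) (toLp u)
  have he : (fun k => coeff u k • X k) = fun k =>
      (lp.single (E := fun _ : G => ℝ) 1 k (toLp u k) : WeightedL1 W) := funext fun k => by
    refine (lp.single_smul (E := fun _ : G => ℝ) 1 k (coeff u k) (W k)).symm.trans ?_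
    rw [coeff, smul_eq_mul, div_mul_cancel₀ _ (weight_pos W k).ne']
  rw [he]
  exact h

/-- Finite combinations of monomials are dense. The algebraic identities below are therefore checked
on monomials, where they reduce to identities in the group. -/
theorem clm_ext {B : Type*} [NormedAddCommGroup B] [NormedSpace ℝ B]
    {L L' : WeightedL1 W →L[ℝ] B} (h : ∀ k, L (X k) = L' (X k)) : L = L' := by
  ext u
  have h1 := (hasSum_coeff_smul_X u).mapL L
  have h2 := (hasSum_coeff_smul_X u).mapL L'
  simp only [map_smul, h] at h1 h2
  exact h1.unique h2

theorem lift_X {B : Type*} [NormedAddCommGroup B] [NormedSpace ℝ B] [CompleteSpace B] {x : G → B} {C : ℝ} (hx : ∀ k, ‖x k‖ ≤ C * W k) (k : G) :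
    lift x C hx (X k) = x k := by
  refine (hasSum_lift hx (X k)).unique ?_
  convert hasSum_ite_eq k (x k) using 2 with l
  rw [coeff_X]
  split_ifs with h
  · rw [one_smul, h]
  · rw [zero_smul]

/-- The convolution product as a continuous bilinear map. -/
def mulL (W : Weight G) : WeightedL1 W →L[ℝ] WeightedL1 W →L[ℝ] WeightedL1 W :=
  lift (fun k => lift (fun l => X (k + l)) (W k)
    (fun l => (norm_X (W := W) (k + l)).trans_le (W.map_add_le k l))) 1
    (fun k => by rw [one_mul]; exact norm_lift_le (weight_pos W k).le _)

theorem mulL_X_X (k l : G) : mulL W (X k) (X l) = X (k + l) := by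
  rw [mulL, lift_X, lift_X]

theorem mulL_comm (u v : WeightedL1 W) : mulL W u v = mulL W v u := by
  have : mulL W = (mulL W).flip := by
    refine clm_ext fun k => clm_ext fun l => ?_
    rw [ContinuousLinearMap.flip_apply, mulL_X_X, mulL_X_X, add_comm]
  exact DFunLike.congr_fun (DFunLike.congr_fun this u) v

/-- The trilinear identity is extended from monomials to general elements one argument at a time. -/
theorem mulL_assoc (u v z : WeightedL1 W) :
    mulL W (mulL W u v) z = mulL W u (mulL W v z) := by
  have h1 : ∀ (k l : G) (z : WeightedL1 W),
      mulL W (mulL W (X k) (X l)) z = mulL W (X k) (mulL W (X l) z) := fun k l => by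
    refine DFunLike.congr_fun (f := mulL W (mulL W (X k) (X l)))
      (g := (mulL W (X k)).comp (mulL W (X l))) (clm_ext fun m => ?_)
    simp only [ContinuousLinearMap.comp_apply, mulL_X_X, add_assoc]
  have h2 : ∀ (k : G) (v z : WeightedL1 W),
      mulL W (mulL W (X k) v) z = mulL W (X k) (mulL W v z) := fun k v z => by
    refine DFunLike.congr_fun (f := ((mulL W).flip z).comp (mulL W (X k)))
      (g := (mulL W (X k)).comp ((mulL W).flip z)) (clm_ext fun m => ?_) v
    exact h1 k m z
  refine DFunLike.congr_fun (f := ((mulL W).flip z).comp ((mulL W).flip v))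
      (g := (mulL W).flip (mulL W v z)) (clm_ext fun m => ?_) u
  exact h2 m v z

theorem mulL_one (u : WeightedL1 W) : mulL W (X 0) u = u := by
  refine DFunLike.congr_fun (f := mulL W (X 0)) (g := ContinuousLinearMap.id ℝ _)
    (clm_ext fun m => ?_) u
  rw [mulL_X_X, zero_add, ContinuousLinearMap.id_apply]

instance : CommRing (WeightedL1 W) where
  __ := (inferInstance : AddCommGroup (WeightedL1 W))
  mul u v := mulL W u v
  one := X 0
  left_distrib u v z := map_add (mulL W u) v z
  right_distrib u v z := by
    change mulL W (u + v) z = mulL W u z + mulL W v z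
    rw [map_add, add_apply]
  zero_mul u := by
    change mulL W 0 u = 0
    rw [map_zero, zero_apply]
  mul_zero u := map_zero (mulL W u)
  mul_assoc := mulL_assoc
  one_mul := mulL_one
  mul_one u := (mulL_comm u (X 0)).trans (mulL_one u)
  mul_comm := mulL_comm

theorem mul_def (u v : WeightedL1 W) : u * v = mulL W u v := rfl

theorem one_def : (1 : WeightedL1 W) = X 0 := rfl

theorem X_mul_X (k l : G) : (X k * X l : WeightedL1 W) = X (k + l) := mulL_X_X k l

instance : NormedCommRing (WeightedL1 W) where
  __ := (inferInstance : NormedAddCommGroup (WeightedL1 W))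
  __ := (inferInstance : CommRing (WeightedL1 W))
  norm_mul_le u v := by
    refine ((mulL W).le_opNorm₂ u v).trans ?_
    have : ‖mulL W‖ ≤ 1 := norm_lift_le zero_le_one _
    rw [mul_assoc]
    exact mul_le_of_le_one_left (mul_nonneg (norm_nonneg _) (norm_nonneg _)) this

instance : NormOneClass (WeightedL1 W) := ⟨by rw [one_def, norm_X, W.map_zero]⟩

instance : Algebra ℝ (WeightedL1 W) :=
  Algebra.ofModule
    (fun r u v => by
      rw [mul_def, mul_def, map_smul, smul_apply])
    (fun r u v => by rw [mul_def, mul_def, map_smul])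

instance : NormedAlgebra ℝ (WeightedL1 W) where
  norm_smul_le r u := (norm_smul r u).le

/-- A continuous linear map that is multiplicative on the monomials is multiplicative. -/
theorem map_mul_of_X {B : Type*} [NormedCommRing B] [NormedAlgebra ℝ B]
    (L : WeightedL1 W →L[ℝ] B) (h : ∀ k l, L (X (k + l)) = L (X k) * L (X l))
    (u v : WeightedL1 W) : L (u * v) = L u * L v := by
  have h1 : ∀ (k : G) (v : WeightedL1 W), L (X k * v) = L (X k) * L v := fun k v => by
    refine DFunLike.congr_fun (f := L.comp (mulL W (X k)))
      (g := (ContinuousLinearMap.mul ℝ B (L (X k))).comp L) (clm_ext fun m => ?_) v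
    simp [mulL_X_X, h]
  refine DFunLike.congr_fun (f := L.comp ((mulL W).flip v))
    (g := ((ContinuousLinearMap.mul ℝ B).flip (L v)).comp L) (clm_ext fun m => ?_) u
  exact h1 m v

/-- The reflection `k ↦ -k` of the coefficients. -/
def reflect (W : Weight G) : WeightedL1 W →L[ℝ] WeightedL1 W :=
  lift (fun k => X (-k)) 1 (fun k => by rw [norm_X, W.map_neg, one_mul])

theorem reflect_X (k : G) : reflect W (X k) = X (-k) := lift_X _ k

theorem norm_reflect_le (u : WeightedL1 W) : ‖reflect W u‖ ≤ ‖u‖ :=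
  ((reflect W).le_opNorm u).trans
    (mul_le_of_le_one_left (norm_nonneg _) (norm_lift_le zero_le_one _))

/-- The multiplier with bounded symbol `m`. -/
def multiplier (W : Weight G) (m : G → ℝ) (C : ℝ) (hm : ∀ k, |m k| ≤ C) :
    WeightedL1 W →L[ℝ] WeightedL1 W :=
  lift (fun k => m k • X k) C (fun k => by
    rw [norm_smul, norm_X, Real.norm_eq_abs]
    exact mul_le_mul_of_nonneg_right (hm k) (weight_pos W k).le)

theorem norm_multiplier_le {m : G → ℝ} {C : ℝ} (hC : 0 ≤ C) (hm : ∀ k, |m k| ≤ C)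
    (u : WeightedL1 W) : ‖multiplier W m C hm u‖ ≤ C * ‖u‖ :=
  ((multiplier W m C hm).le_opNorm u).trans
    (mul_le_mul_of_nonneg_right (norm_lift_le hC _) (norm_nonneg _))

/-- The coefficient at `k` as a continuous linear functional. -/
def coeffL (W : Weight G) (k : G) : WeightedL1 W →L[ℝ] ℝ :=
  LinearMap.mkContinuous
    { toFun := fun u => coeff u k
      map_add' := fun u v => coeff_add u v k
      map_smul' := fun c u => coeff_smul c u k } 1
    (fun u => by rw [one_mul]; exact abs_coeff_le u k)

theorem coeffL_apply (k : G) (u : WeightedL1 W) : coeffL W k u = coeff u k := rfl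

theorem coeff_multiplier {m : G → ℝ} {C : ℝ} (hm : ∀ k, |m k| ≤ C)
    (u : WeightedL1 W) (k : G) : coeff (multiplier W m C hm u) k = m k * coeff u k := by
  refine DFunLike.congr_fun (f := (coeffL W k).comp (multiplier W m C hm))
    (g := m k • coeffL W k) (clm_ext fun l => ?_) u
  simp only [ContinuousLinearMap.comp_apply, multiplier, lift_X, smul_apply,
    coeffL_apply, coeff_smul, coeff_X, smul_eq_mul]
  split_ifs with h
  · rw [h]
  · simp

/-- Evaluation at a bounded character of `G`. -/
def eval (W : Weight G) (χ : G → ℂ) (h1 : ∀ k, ‖χ k‖ = 1) : WeightedL1 W →L[ℝ] ℂ :=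
  lift χ 1 (fun k => by rw [h1, one_mul]; exact W.one_le k)

theorem hasSum_eval {χ : G → ℂ} (h1 : ∀ k, ‖χ k‖ = 1) (u : WeightedL1 W) :
    HasSum (fun k => (coeff u k : ℂ) * χ k) (eval W χ h1 u) := by
  have h := hasSum_lift (W := W) (x := χ) (C := 1)
    (fun k => by rw [h1, one_mul]; exact W.one_le k) u
  simp only [Complex.real_smul] at h
  exact h

theorem norm_eval_le {χ : G → ℂ} (h1 : ∀ k, ‖χ k‖ = 1) (u : WeightedL1 W) :
    ‖eval W χ h1 u‖ ≤ ‖u‖ :=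
  ((eval W χ h1).le_opNorm u).trans
    (mul_le_of_le_one_left (norm_nonneg _) (norm_lift_le zero_le_one _))

theorem eval_mul {χ : G → ℂ} (h1 : ∀ k, ‖χ k‖ = 1) (hχ : ∀ k l, χ (k + l) = χ k * χ l)
    (u v : WeightedL1 W) : eval W χ h1 (u * v) = eval W χ h1 u * eval W χ h1 v :=
  map_mul_of_X _ (fun k l => by simp only [eval, lift_X, hχ]) u v

theorem eval_one {χ : G → ℂ} (h1 : ∀ k, ‖χ k‖ = 1) (h0 : χ 0 = 1) :
    eval W χ h1 1 = 1 := by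
  rw [one_def, eval, lift_X, h0]

/-- Because the coefficients are real, conjugation acts on the characters alone. This is why real
coefficients suffice to represent `ū` inside the same algebra. -/
theorem eval_reflect {χ : G → ℂ} (h1 : ∀ k, ‖χ k‖ = 1)
    (hneg : ∀ k, χ (-k) = starRingEnd ℂ (χ k)) (u : WeightedL1 W) :
    eval W χ h1 (reflect W u) = starRingEnd ℂ (eval W χ h1 u) := by
  refine DFunLike.congr_fun (f := (eval W χ h1).comp (reflect W))
    (g := (Complex.conjCLE : ℂ →L[ℝ] ℂ).comp (eval W χ h1)) (clm_ext fun l => ?_) u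
  simp [reflect_X, eval, lift_X, hneg]

end WeightedL1

/-! ### The power series of `∂H/∂ū` in a commutative Banach algebra. -/

section PowerSeries

variable {B : Type*} [NormedCommRing B]

theorem norm_pow_sub_pow_le [NormOneClass B] {u v : B} {s : ℝ} (hu : ‖u‖ ≤ s) (hv : ‖v‖ ≤ s)
    (n : ℕ) : ‖u ^ n - v ^ n‖ ≤ n * s ^ (n - 1) * ‖u - v‖ := by
  have hs : 0 ≤ s := (norm_nonneg u).trans hu
  induction n with
  | zero => simp
  | succ n ih =>
    have h1 : u ^ (n + 1) - v ^ (n + 1) = u ^ n * (u - v) + (u ^ n - v ^ n) * v := by ring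
    have h2 : (n : ℝ) * s ^ (n - 1) * s = n * s ^ n := by
      rcases n with _ | n
      · simp
      · rw [Nat.add_sub_cancel, pow_succ]; ring
    calc ‖u ^ (n + 1) - v ^ (n + 1)‖
        ≤ ‖u ^ n‖ * ‖u - v‖ + ‖u ^ n - v ^ n‖ * ‖v‖ := by
          rw [h1]
          exact (norm_add_le _ _).trans (add_le_add (norm_mul_le _ _) (norm_mul_le _ _))
      _ ≤ s ^ n * ‖u - v‖ + (n * s ^ (n - 1) * ‖u - v‖) * s := by
          have h3 : ‖u ^ n‖ ≤ s ^ n :=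
            (norm_pow_le _ _).trans (pow_le_pow_left₀ (norm_nonneg _) hu n)
          gcongr
      _ = ((n + 1 : ℕ) : ℝ) * s ^ (n + 1 - 1) * ‖u - v‖ := by
          have : (n : ℝ) * s ^ (n - 1) * ‖u - v‖ * s = (n * s ^ n) * ‖u - v‖ := by
            rw [← h2]; ring
          rw [this, Nat.add_sub_cancel]; push_cast; ring

/-- A mean value estimate, changing one factor at a time. The truncated exponent at `p + m = 0` is
harmless, since its factor is zero. -/
theorem norm_monomial_sub_le [NormOneClass B] {u v u' v' : B} {s δ : ℝ} (hu : ‖u‖ ≤ s)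
    (hv : ‖v‖ ≤ s) (hu' : ‖u'‖ ≤ s) (hv' : ‖v'‖ ≤ s) (hδ : ‖u - u'‖ ≤ δ) (hδ' : ‖v - v'‖ ≤ δ)
    (p m : ℕ) :
    ‖u ^ p * v ^ m - u' ^ p * v' ^ m‖ ≤ ((p + m : ℕ) : ℝ) * s ^ (p + m - 1) * δ := by
  have hs : 0 ≤ s := (norm_nonneg u).trans hu
  have hδ0 : 0 ≤ δ := (norm_nonneg _).trans hδ
  have h1 : u ^ p * v ^ m - u' ^ p * v' ^ m
      = (u ^ p - u' ^ p) * v ^ m + u' ^ p * (v ^ m - v' ^ m) := by ring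
  have hvm : ‖v ^ m‖ ≤ s ^ m := (norm_pow_le _ _).trans (pow_le_pow_left₀ (norm_nonneg _) hv m)
  have hup : ‖u' ^ p‖ ≤ s ^ p := (norm_pow_le _ _).trans (pow_le_pow_left₀ (norm_nonneg _) hu' p)
  have e1 : (p : ℝ) * s ^ (p - 1) * s ^ m = p * s ^ (p + m - 1) := by
    rcases p with _ | p
    · simp
    · rw [Nat.add_sub_cancel, mul_assoc, ← pow_add]; congr 2; omega
  have e2 : s ^ p * ((m : ℝ) * s ^ (m - 1)) = m * s ^ (p + m - 1) := by
    rcases m with _ | m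
    · simp
    · rw [Nat.add_sub_cancel, mul_left_comm, ← pow_add]; congr 2
  calc ‖u ^ p * v ^ m - u' ^ p * v' ^ m‖
      ≤ ‖u ^ p - u' ^ p‖ * ‖v ^ m‖ + ‖u' ^ p‖ * ‖v ^ m - v' ^ m‖ := by
        rw [h1]
        exact (norm_add_le _ _).trans (add_le_add (norm_mul_le _ _) (norm_mul_le _ _))
    _ ≤ (p * s ^ (p - 1) * δ) * s ^ m + s ^ p * (m * s ^ (m - 1) * δ) := by
        have h3 := (norm_pow_sub_pow_le hu hu' p).trans
          (mul_le_mul_of_nonneg_left hδ (by positivity))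
        have h4 := (norm_pow_sub_pow_le hv hv' m).trans
          (mul_le_mul_of_nonneg_left hδ' (by positivity))
        gcongr
    _ = (p * s ^ (p - 1) * s ^ m) * δ + (s ^ p * (m * s ^ (m - 1))) * δ := by ring
    _ = ((p + m : ℕ) : ℝ) * s ^ (p + m - 1) * δ := by
        rw [e1, e2]; push_cast; ring

/-- The term of index `(l, l')` of `∂/∂v ∑ α_{l,l'} u^l v^{l'}`. -/
def gradTerm [NormedAlgebra ℝ B] (α : ℕ → ℕ → ℝ) (u v : B) (p : ℕ × ℕ) : B :=
  (α p.1 p.2 * p.2) • (u ^ p.1 * v ^ (p.2 - 1))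

/-- The series `∂/∂v ∑ α_{l,l'} u^l v^{l'}` in a commutative Banach algebra. -/
def gradSeries [NormedAlgebra ℝ B] (α : ℕ → ℕ → ℝ) (u v : B) : B := ∑' p, gradTerm α u v p

/-- The majorant `|α_{l,l'}| l' (l + l') r^{l + l' - 5}` of the first derivatives of the terms of
`gradSeries`. -/
def gradBound (α : ℕ → ℕ → ℝ) (r : ℝ) (p : ℕ × ℕ) : ℝ :=
  |α p.1 p.2| * p.2 * (p.1 + p.2 : ℕ) * r ^ (p.1 + p.2) / r ^ 5

theorem gradBound_nonneg (α : ℕ → ℕ → ℝ) {r : ℝ} (hr : 0 < r) (p : ℕ × ℕ) :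
    0 ≤ gradBound α r p := by
  unfold gradBound; positivity

/-- The polynomial factor `l' (l + l')` is at most `4 ^ (l + l')`; this is the reason for asking
convergence at radius `4 * r`. -/
theorem summable_gradBound {α : ℕ → ℕ → ℝ} {r : ℝ} (hr : 0 < r) (h : ConvergesOn α (4 * r)) :
    Summable (gradBound α r) := by
  refine Summable.div_const ?_ _
  refine Summable.of_nonneg_of_le (fun p => by positivity) (fun p => ?_) h
  rw [mul_pow]
  have h1 : ((p.1 + p.2 : ℕ) : ℝ) ≤ 2 ^ (p.1 + p.2) := by
    exact_mod_cast (Nat.lt_two_pow_self (n := p.1 + p.2)).le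
  have h2 : (p.2 : ℝ) ≤ 2 ^ (p.1 + p.2) := by
    refine le_trans ?_ h1
    push_cast
    linarith [Nat.cast_nonneg (α := ℝ) p.1]
  have h3 : (p.2 : ℝ) * (p.1 + p.2 : ℕ) ≤ 4 ^ (p.1 + p.2) := by
    calc (p.2 : ℝ) * (p.1 + p.2 : ℕ) ≤ 2 ^ (p.1 + p.2) * 2 ^ (p.1 + p.2) := by gcongr
      _ = 4 ^ (p.1 + p.2) := by rw [← mul_pow]; norm_num
  calc |α p.1 p.2| * p.2 * (p.1 + p.2 : ℕ) * r ^ (p.1 + p.2)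
      = |α p.1 p.2| * ((p.2 : ℝ) * (p.1 + p.2 : ℕ)) * r ^ (p.1 + p.2) := by ring
    _ ≤ |α p.1 p.2| * 4 ^ (p.1 + p.2) * r ^ (p.1 + p.2) := by gcongr
    _ = _ := by ring

/-- A term of `H` of degree at least five loses one degree in `∂/∂ū` and one more in the Lipschitz
estimate, so `s ^ 3` can be factored out and the rest bounded at radius `r`. Terms with `l' = 0`,
where `l' - 1` truncates, vanish. -/
theorem mul_pow_le_gradBound {α : ℕ → ℕ → ℝ} (hα : IsAdmissible α) {r s : ℝ}
    (hr : 0 < r) (hs : 0 ≤ s) (hsr : s ≤ r) (p : ℕ × ℕ) :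
    |α p.1 p.2 * p.2| * ((p.1 + (p.2 - 1) : ℕ) * s ^ (p.1 + (p.2 - 1) - 1))
      ≤ gradBound α r p * s ^ 3 := by
  by_cases h5 : p.1 + p.2 < 5
  · rw [hα.order_ge_five _ _ h5, zero_mul, abs_zero, zero_mul]
    exact mul_nonneg (gradBound_nonneg α hr p) (by positivity)
  by_cases h0 : p.2 = 0
  · rw [h0, Nat.cast_zero, mul_zero, abs_zero, zero_mul]
    exact mul_nonneg (gradBound_nonneg α hr p) (by positivity)
  obtain ⟨N, hN⟩ : ∃ N, p.1 + p.2 = N + 5 := ⟨p.1 + p.2 - 5, by omega⟩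
  have e1 : p.1 + (p.2 - 1) = N + 4 := by omega
  have e2 : N + 4 - 1 = N + 3 := by omega
  rw [gradBound, hN, e1, e2, abs_mul, Nat.abs_cast, pow_add r, ← mul_assoc (_ * _) (r ^ N),
    mul_div_assoc, div_self (pow_pos hr 5).ne', mul_one, pow_add s N 3]
  have h1 : s ^ N ≤ r ^ N := pow_le_pow_left₀ hs hsr N
  have h2 : ((N + 4 : ℕ) : ℝ) ≤ ((N + 5 : ℕ) : ℝ) := by push_cast; linarith
  calc |α p.1 p.2| * p.2 * (((N + 4 : ℕ) : ℝ) * (s ^ N * s ^ 3))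
      ≤ |α p.1 p.2| * p.2 * (((N + 5 : ℕ) : ℝ) * (r ^ N * s ^ 3)) := by gcongr
    _ = _ := by ring

variable [NormedAlgebra ℝ B]

theorem gradTerm_zero {α : ℕ → ℕ → ℝ} (hα : IsAdmissible α) (p : ℕ × ℕ) :
    gradTerm α (0 : B) 0 p = 0 := by
  unfold gradTerm
  by_cases h5 : p.1 + p.2 < 5
  · rw [hα.order_ge_five _ _ h5, zero_mul, zero_smul]
  rw [← pow_add, zero_pow (by omega), smul_zero]

theorem gradSeries_zero {α : ℕ → ℕ → ℝ} (hα : IsAdmissible α) :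
    gradSeries α (0 : B) 0 = 0 := by
  simp [gradSeries, gradTerm_zero hα]

variable [NormOneClass B]

theorem norm_gradTerm_sub_le {α : ℕ → ℕ → ℝ} (hα : IsAdmissible α) {r : ℝ} (hr : 0 < r)
    {u v u' v' : B} {s δ : ℝ} (hu : ‖u‖ ≤ s)
    (hv : ‖v‖ ≤ s) (hu' : ‖u'‖ ≤ s) (hv' : ‖v'‖ ≤ s) (hsr : s ≤ r)
    (hδ : ‖u - u'‖ ≤ δ) (hδ' : ‖v - v'‖ ≤ δ) (p : ℕ × ℕ) :
    ‖gradTerm α u v p - gradTerm α u' v' p‖ ≤ gradBound α r p * (s ^ 3 * δ) := by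
  have hs : 0 ≤ s := (norm_nonneg u).trans hu
  have hδ0 : 0 ≤ δ := (norm_nonneg _).trans hδ
  rw [gradTerm, gradTerm, ← smul_sub, norm_smul, Real.norm_eq_abs]
  calc _ ≤ |α p.1 p.2 * p.2| *
        (((p.1 + (p.2 - 1) : ℕ) : ℝ) * s ^ (p.1 + (p.2 - 1) - 1) * δ) :=
        mul_le_mul_of_nonneg_left (norm_monomial_sub_le hu hv hu' hv' hδ hδ' _ _) (abs_nonneg _)
    _ = (|α p.1 p.2 * p.2| * ((p.1 + (p.2 - 1) : ℕ) * s ^ (p.1 + (p.2 - 1) - 1))) * δ := by ring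
    _ ≤ (gradBound α r p * s ^ 3) * δ :=
        mul_le_mul_of_nonneg_right (mul_pow_le_gradBound hα hr hs hsr p) hδ0
    _ = _ := by ring

theorem norm_gradTerm_le {α : ℕ → ℕ → ℝ} (hα : IsAdmissible α) {r : ℝ} (hr : 0 < r)
    {u v : B} {s : ℝ} (hu : ‖u‖ ≤ s) (hv : ‖v‖ ≤ s) (hsr : s ≤ r) (p : ℕ × ℕ) :
    ‖gradTerm α u v p‖ ≤ gradBound α r p * (s ^ 3 * s) := by
  have hs : 0 ≤ s := (norm_nonneg u).trans hu
  have h := norm_gradTerm_sub_le hα hr hu hv (u' := 0) (v' := 0) (by simpa) (by simpa) hsr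
    (by simpa using hu) (by simpa using hv) p
  rwa [gradTerm_zero hα, sub_zero] at h

variable [CompleteSpace B]

theorem summable_gradTerm {α : ℕ → ℕ → ℝ} (hα : IsAdmissible α) {r : ℝ} (hr : 0 < r)
    (hc : ConvergesOn α (4 * r)) {u v : B} (hu : ‖u‖ ≤ r) (hv : ‖v‖ ≤ r) :
    Summable (gradTerm α u v) :=
  Summable.of_norm_bounded ((summable_gradBound hr hc).mul_right _)
    (norm_gradTerm_le hα hr hu hv le_rfl)

theorem norm_gradSeries_sub_le {α : ℕ → ℕ → ℝ} (hα : IsAdmissible α) {r : ℝ} (hr : 0 < r)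
    (hc : ConvergesOn α (4 * r)) {u v u' v' : B} {s δ : ℝ} (hu : ‖u‖ ≤ s)
    (hv : ‖v‖ ≤ s) (hu' : ‖u'‖ ≤ s) (hv' : ‖v'‖ ≤ s) (hsr : s ≤ r)
    (hδ : ‖u - u'‖ ≤ δ) (hδ' : ‖v - v'‖ ≤ δ) :
    ‖gradSeries α u v - gradSeries α u' v'‖ ≤ (∑' p, gradBound α r p) * (s ^ 3 * δ) := by
  rw [gradSeries, gradSeries,
    ← (summable_gradTerm hα hr hc (hu.trans hsr) (hv.trans hsr)).tsum_sub
      (summable_gradTerm hα hr hc (hu'.trans hsr) (hv'.trans hsr))]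
  exact tsum_of_norm_bounded ((summable_gradBound hr hc).hasSum.mul_right _)
    (norm_gradTerm_sub_le hα hr hu hv hu' hv' hsr hδ hδ')

theorem map_gradSeries {α : ℕ → ℕ → ℝ} (hα : IsAdmissible α) {r : ℝ} (hr : 0 < r)
    (hc : ConvergesOn α (4 * r)) {u v : B} (hu : ‖u‖ ≤ r) (hv : ‖v‖ ≤ r)
    (φ : B →L[ℝ] ℂ) (h1 : φ 1 = 1) (hmul : ∀ x y, φ (x * y) = φ x * φ y) :
    φ (gradSeries α u v) = gradSeries α (φ u) (φ v) := by
  have hpow : ∀ (x : B) (n : ℕ), φ (x ^ n) = φ x ^ n := fun x n => by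
    induction n with
    | zero => rw [pow_zero, pow_zero, h1]
    | succ n ih => rw [pow_succ, pow_succ, hmul, ih]
  rw [gradSeries, φ.map_tsum (summable_gradTerm hα hr hc hu hv), gradSeries]
  simp only [gradTerm, map_smul, hmul, hpow]

end PowerSeries

/-- Termwise differentiation in `w`, justified by a summable majorant of the derivatives on the disc
of radius `r`. It ties the analytic derivative to the algebraic series. -/
theorem dHbar_eq {α : ℕ → ℕ → ℝ} (hα : IsAdmissible α) {r : ℝ} (hr : 0 < r)
    (hc : ConvergesOn α (4 * r)) {z : ℂ} (hz : ‖z‖ < r) :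
    dHbar α z = 2 * (z * z * starRingEnd ℂ z) + gradSeries α z (starRingEnd ℂ z) := by
  have hz' : ‖starRingEnd ℂ z‖ < r := by rwa [RCLike.norm_conj]
  have hser : HasDerivAt (fun w : ℂ => ∑' p : ℕ × ℕ, (α p.1 p.2 : ℂ) * z ^ p.1 * w ^ p.2)
      (∑' p : ℕ × ℕ, (α p.1 p.2 : ℂ) * z ^ p.1 * (p.2 * (starRingEnd ℂ z) ^ (p.2 - 1)))
      (starRingEnd ℂ z) := by
    refine hasDerivAt_tsum_of_isPreconnected (t := Metric.ball (0 : ℂ) r) (y₀ := 0)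
      ((summable_gradBound hr hc).mul_right (r ^ 3 * r))
      Metric.isOpen_ball (convex_ball (0 : ℂ) r).isPreconnected
      (fun p w _ => (hasDerivAt_pow p.2 w).const_mul _) (fun p w hw => ?_)
      (Metric.mem_ball_self hr) ?_ (by simpa using hz)
    · have hw : ‖w‖ ≤ r := (mem_ball_zero_iff.1 hw).le
      have h := norm_gradTerm_le hα hr hz.le hw le_rfl p
      have he : (α p.1 p.2 : ℂ) * z ^ p.1 * (p.2 * w ^ (p.2 - 1)) = gradTerm α z w p := by
        rw [gradTerm, Complex.real_smul]
        push_cast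
        ring
      rwa [he]
    · refine Summable.of_norm_bounded hc fun p => ?_
      rw [norm_mul, norm_mul, norm_pow, norm_pow, Complex.norm_real, Real.norm_eq_abs, norm_zero,
        mul_assoc, pow_add]
      have h1 : ‖z‖ ^ p.1 ≤ (4 * r) ^ p.1 :=
        pow_le_pow_left₀ (norm_nonneg _) (by linarith) _
      have h2 : (0 : ℝ) ^ p.2 ≤ (4 * r) ^ p.2 := pow_le_pow_left₀ le_rfl (by linarith) _
      gcongr
  have hsq : HasDerivAt (fun w : ℂ => z ^ 2 * w ^ 2) (z ^ 2 * (2 * starRingEnd ℂ z))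
      (starRingEnd ℂ z) := by
    simpa using (hasDerivAt_pow 2 (starRingEnd ℂ z)).const_mul (z ^ 2)
  have := (hsq.add hser).deriv
  refine Eq.trans this ?_
  congr 1
  · ring
  · refine tsum_congr fun p => ?_
    rw [gradTerm, Complex.real_smul]
    push_cast
    ring

/-! ### Termwise differentiation of exponential sums. -/

section ExpSum

variable {ι V F : Type*} [NormedAddCommGroup V] [NormedSpace ℝ V] [NormedAddCommGroup F]
  [NormedSpace ℂ F]

/-- The exponential sum `∑ exp(i L_j(v)) c_j`. -/
def expSum (L : ι → V →L[ℝ] ℝ) (c : ι → F) (v : V) : F :=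
  ∑' i, Complex.exp (Complex.I * (L i v : ℝ)) • c i

/-- The coefficients of the derivative of an exponential sum. -/
def expSumDeriv (L : ι → V →L[ℝ] ℝ) (c : ι → F) (i : ι) : V →L[ℝ] F :=
  (L i).smulRight (Complex.I • c i)

theorem norm_exp_I_mul (x : ℝ) : ‖Complex.exp (Complex.I * x)‖ = 1 := by
  rw [mul_comm, Complex.norm_exp_ofReal_mul_I]

theorem norm_expSumDeriv (L : ι → V →L[ℝ] ℝ) (c : ι → F) (i : ι) :
    ‖expSumDeriv L c i‖ = ‖L i‖ * ‖c i‖ := by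
  rw [expSumDeriv, ContinuousLinearMap.norm_smulRight_apply, norm_smul, Complex.norm_I, one_mul]

theorem hasFDerivAt_exp_smul (L : ι → V →L[ℝ] ℝ) (c : ι → F) (i : ι) (v : V) :
    HasFDerivAt (fun v => Complex.exp (Complex.I * (L i v : ℝ)) • c i)
      (Complex.exp (Complex.I * (L i v : ℝ)) • expSumDeriv L c i) v := by
  have h1 : HasFDerivAt (fun v => ((L i v : ℝ) : ℂ)) (Complex.ofRealCLM.comp (L i)) v :=
    Complex.ofRealCLM.hasFDerivAt.comp v (L i).hasFDerivAt
  have h2 := ((h1.const_mul Complex.I).cexp).smul_const (c i)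
  refine h2.congr_fderiv ?_
  ext x
  simp only [expSumDeriv, ContinuousLinearMap.smulRight_apply, smul_apply,
    ContinuousLinearMap.comp_apply, Complex.ofRealCLM_apply, smul_eq_mul]
  rw [← Complex.coe_smul (L i x), smul_smul, smul_smul]
  congr 1
  ring

variable [CompleteSpace F]

theorem summable_exp_smul (L : ι → V →L[ℝ] ℝ) {c : ι → F} (h0 : Summable fun i => ‖c i‖) (v : V) :
    Summable fun i => Complex.exp (Complex.I * (L i v : ℝ)) • c i :=
  Summable.of_norm (by simpa only [norm_smul, norm_exp_I_mul, one_mul] using h0)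

theorem hasFDerivAt_expSum {L : ι → V →L[ℝ] ℝ} {c : ι → F} (h0 : Summable fun i => ‖c i‖)
    (h1 : Summable fun i => ‖L i‖ * ‖c i‖) (v : V) :
    HasFDerivAt (expSum L c) (expSum L (expSumDeriv L c) v) v := by
  refine hasFDerivAt_tsum h1 (fun i v => hasFDerivAt_exp_smul L c i v) (fun i v => ?_)
    (summable_exp_smul L h0 0) v
  rw [norm_smul, norm_exp_I_mul, one_mul, norm_expSumDeriv]

theorem continuous_expSum {L : ι → V →L[ℝ] ℝ} {c : ι → F} (h0 : Summable fun i => ‖c i‖) :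
    Continuous (expSum L c) := by
  refine continuous_tsum (fun i => ?_) h0 fun i v => ?_
  · fun_prop
  · rw [norm_smul, norm_exp_I_mul, one_mul]

theorem fderiv_expSum {L : ι → V →L[ℝ] ℝ} {c : ι → F} (h0 : Summable fun i => ‖c i‖)
    (h1 : Summable fun i => ‖L i‖ * ‖c i‖) :
    fderiv ℝ (expSum L c) = expSum L (expSumDeriv L c) :=
  funext fun v => (hasFDerivAt_expSum h0 h1 v).fderiv

theorem contDiff_one_expSum {L : ι → V →L[ℝ] ℝ} {c : ι → F} (h0 : Summable fun i => ‖c i‖)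
    (h1 : Summable fun i => ‖L i‖ * ‖c i‖) : ContDiff ℝ 1 (expSum L c) := by
  rw [contDiff_one_iff_fderiv]
  refine ⟨fun v => (hasFDerivAt_expSum h0 h1 v).differentiableAt, ?_⟩
  rw [fderiv_expSum h0 h1]
  exact continuous_expSum (by simpa only [norm_expSumDeriv] using h1)

theorem contDiff_two_expSum {L : ι → V →L[ℝ] ℝ} {c : ι → F} (h0 : Summable fun i => ‖c i‖)
    (h1 : Summable fun i => ‖L i‖ * ‖c i‖) (h2 : Summable fun i => ‖L i‖ * (‖L i‖ * ‖c i‖)) :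
    ContDiff ℝ 2 (expSum L c) := by
  rw [show (2 : WithTop ℕ∞) = 1 + 1 by norm_num, contDiff_succ_iff_fderiv]
  refine ⟨fun v => (hasFDerivAt_expSum h0 h1 v).differentiableAt, by simp, ?_⟩
  rw [fderiv_expSum h0 h1]
  exact contDiff_one_expSum (by simpa only [norm_expSumDeriv] using h1)
    (by simpa only [norm_expSumDeriv] using h2)

theorem expSum_apply {L : ι → V →L[ℝ] ℝ} {c : ι → V →L[ℝ] F} (h0 : Summable fun i => ‖c i‖)
    (v e : V) : expSum L c v e = expSum L (fun i => c i e) v := by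
  have := (ContinuousLinearMap.apply ℝ F e).map_tsum (summable_exp_smul L h0 v)
  exact this

theorem iteratedFDeriv_two_expSum {L : ι → V →L[ℝ] ℝ} {c : ι → F}
    (h0 : Summable fun i => ‖c i‖) (h1 : Summable fun i => ‖L i‖ * ‖c i‖)
    (h2 : Summable fun i => ‖L i‖ * (‖L i‖ * ‖c i‖)) (v e : V) :
    iteratedFDeriv ℝ 2 (expSum L c) v ![e, e] = expSum L (fun i => -((L i e) ^ 2 : ℂ) • c i) v := by
  have h1' : Summable fun i => ‖expSumDeriv L c i‖ := by simpa only [norm_expSumDeriv] using h1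
  have h2' : Summable fun i => ‖expSumDeriv L (expSumDeriv L c) i‖ := by
    simpa only [norm_expSumDeriv] using h2
  have h3' : Summable fun i => ‖expSumDeriv L (expSumDeriv L c) i e‖ :=
    Summable.of_nonneg_of_le (fun _ => norm_nonneg _)
      (fun i => (expSumDeriv L (expSumDeriv L c) i).le_opNorm e) (h2'.mul_right ‖e‖)
  rw [iteratedFDeriv_two_apply, fderiv_expSum h0 h1, fderiv_expSum h1'
    (by simpa only [norm_expSumDeriv] using h2)]
  simp only [Matrix.cons_val_zero, Matrix.cons_val_one]
  rw [expSum_apply h2', expSum_apply h3']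
  congr 1
  ext i
  simp only [expSumDeriv, ContinuousLinearMap.smulRight_apply, smul_apply]
  rw [← Complex.coe_smul (L i e), ← Complex.coe_smul (L i e), smul_smul, smul_smul, smul_smul]
  congr 1
  linear_combination (L i e : ℂ) ^ 2 * Complex.I_mul_I

theorem deriv_expSum {L : ι → ℝ →L[ℝ] ℝ} {c : ι → F}
    (h0 : Summable fun i => ‖c i‖) (h1 : Summable fun i => ‖L i‖ * ‖c i‖) (t : ℝ) :
    deriv (expSum L c) t = expSum L (fun i => ((L i 1 : ℂ) * Complex.I) • c i) t := by
  have h1' : Summable fun i => ‖expSumDeriv L c i‖ := by simpa only [norm_expSumDeriv] using h1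
  rw [(hasFDerivAt_expSum h0 h1 t).hasDerivAt.deriv, expSum_apply h1']
  congr 1
  ext i
  simp only [expSumDeriv, ContinuousLinearMap.smulRight_apply]
  rw [← Complex.coe_smul, smul_smul]

theorem laplacian_expSum {d : ℕ} {L : ι → EuclideanSpace ℝ (Fin d) →L[ℝ] ℝ} {c : ι → F}
    (h0 : Summable fun i => ‖c i‖) (h1 : Summable fun i => ‖L i‖ * ‖c i‖)
    (h2 : Summable fun i => ‖L i‖ * (‖L i‖ * ‖c i‖)) (x : EuclideanSpace ℝ (Fin d)) :
    Laplacian.laplacian (expSum L c) x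
      = expSum L (fun i => -(∑ j, (L i (EuclideanSpace.single j 1)) ^ 2 : ℂ) • c i) x := by
  rw [InnerProductSpace.laplacian_eq_iteratedFDeriv_orthonormalBasis _
    (EuclideanSpace.basisFun (Fin d) ℝ)]
  simp only [EuclideanSpace.basisFun_apply, iteratedFDeriv_two_expSum h0 h1 h2]
  have hs : ∀ j : Fin d, Summable fun i =>
      Complex.exp (Complex.I * (L i x : ℝ)) • (-((L i (EuclideanSpace.single j 1)) ^ 2 : ℂ) • c i) :=
    fun j => by
    refine summable_exp_smul L (Summable.of_nonneg_of_le (fun _ => norm_nonneg _) (fun i => ?_) h2) x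
    have h := (L i).le_opNorm (EuclideanSpace.single j 1)
    rw [PiLp.norm_single, norm_one, mul_one] at h
    rw [norm_smul, norm_neg, norm_pow, Complex.norm_real, ← mul_assoc, ← pow_two]
    gcongr
  unfold expSum
  rw [← Summable.tsum_finsetSum fun j _ => hs j]
  refine tsum_congr fun i => ?_
  rw [← Finset.smul_sum, ← Finset.sum_smul, Finset.sum_neg_distrib]

end ExpSum

/-! ### Lattice estimates and the absence of small divisors. -/

/-- The `ℓ¹` length of an integer vector. -/
def l1Norm {b : ℕ} (k : Fin b → ℤ) : ℝ := ∑ j, |(k j : ℝ)|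

theorem l1Norm_nonneg {b : ℕ} (k : Fin b → ℤ) : 0 ≤ l1Norm k :=
  Finset.sum_nonneg fun _ _ => abs_nonneg _

theorem abs_le_l1Norm {b : ℕ} (k : Fin b → ℤ) (j : Fin b) : |(k j : ℝ)| ≤ l1Norm k :=
  Finset.single_le_sum (f := fun j => |(k j : ℝ)|) (fun _ _ => abs_nonneg _) (Finset.mem_univ j)

/-- The weight `exp(M |k|₁)`. -/
def expWeight (b : ℕ) (M : ℝ) (hM : 0 ≤ M) : Weight (Fin b → ℤ) where
  toFun k := Real.exp (M * l1Norm k)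
  one_le k := Real.one_le_exp (mul_nonneg hM (l1Norm_nonneg k))
  map_zero := by simp [l1Norm]
  map_add_le k l := by
    rw [← Real.exp_add, ← mul_add]
    refine Real.exp_le_exp.2 (mul_le_mul_of_nonneg_left ?_ hM)
    unfold l1Norm
    rw [← Finset.sum_add_distrib]
    refine Finset.sum_le_sum fun j _ => ?_
    rw [Pi.add_apply, Int.cast_add]
    exact abs_add_le _ _
  map_neg k := by simp [l1Norm]

theorem sqNorm_eq_norm_sq {r : ℕ} (m : Fin r → ℤ) : (sqNorm m : ℝ) = ‖toVec m‖ ^ 2 := by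
  rw [EuclideanSpace.norm_sq_eq]
  simp [sqNorm, toVec]

/-- The spatial frequency `∑ k_j n_j`. -/
def wave {b d : ℕ} (n : Fin b → Fin d → ℤ) (k : Fin b → ℤ) : Fin d → ℤ := ∑ j, k j • n j

theorem wave_add {b d : ℕ} (n : Fin b → Fin d → ℤ) (k l : Fin b → ℤ) :
    wave n (k + l) = wave n k + wave n l := by
  simp [wave, add_smul, Finset.sum_add_distrib]

theorem wave_single {b d : ℕ} (n : Fin b → Fin d → ℤ) (j : Fin b) :
    wave n (Pi.single j 1) = n j := by
  simp [wave, Pi.single_apply]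

theorem toVec_wave {b d : ℕ} (n : Fin b → Fin d → ℤ) (k : Fin b → ℤ) :
    toVec (wave n k) = ∑ j, (k j : ℝ) • toVec (n j) := by
  ext i
  simp [toVec, wave]

theorem norm_toVec_wave_le {b d : ℕ} (n : Fin b → Fin d → ℤ) (k : Fin b → ℤ) :
    ‖toVec (wave n k)‖ ≤ (∑ j, ‖toVec (n j)‖) * l1Norm k := by
  rw [toVec_wave, Finset.sum_mul]
  refine (norm_sum_le _ _).trans (Finset.sum_le_sum fun j _ => ?_)
  rw [norm_smul, Real.norm_eq_abs, mul_comm]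
  exact mul_le_mul_of_nonneg_left (abs_le_l1Norm k j) (norm_nonneg _)

theorem sqNorm_le_l1Norm_sq {b : ℕ} (k : Fin b → ℤ) : (sqNorm k : ℝ) ≤ l1Norm k ^ 2 := by
  have h : (sqNorm k : ℝ) = ∑ j, |(k j : ℝ)| ^ 2 := by simp [sqNorm]
  rw [h]
  exact Finset.sum_sq_le_sq_sum_of_nonneg fun _ _ => abs_nonneg _

theorem idxNorm_wave_le {b d : ℕ} (n : Fin b → Fin d → ℤ) (k : Fin b → ℤ) :
    idxNorm (wave n k, k) ≤ ((∑ j, ‖toVec (n j)‖) + 1) * l1Norm k := by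
  have hA : 0 ≤ ∑ j, ‖toVec (n j)‖ := Finset.sum_nonneg fun _ _ => norm_nonneg _
  have hS := l1Norm_nonneg k
  refine Real.sqrt_le_iff.2 ⟨by positivity, ?_⟩
  have h1 : (sqNorm (wave n k) : ℝ) ≤ ((∑ j, ‖toVec (n j)‖) * l1Norm k) ^ 2 := by
    rw [sqNorm_eq_norm_sq]
    exact pow_le_pow_left₀ (norm_nonneg _) (norm_toVec_wave_le n k) 2
  have h2 := sqNorm_le_l1Norm_sq k
  have h3 : 0 ≤ (∑ j, ‖toVec (n j)‖) * l1Norm k * l1Norm k := by positivity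
  simp only
  nlinarith

/-- An injective linear map on a finite-dimensional space is bounded below. -/
theorem exists_mul_sq_le_sqNorm_wave {b d : ℕ} {n : Fin b → Fin d → ℤ}
    (hn : LinearIndependent ℝ (fun j => toVec (n j))) :
    ∃ c : ℝ, 0 < c ∧ ∀ k, c * l1Norm k ^ 2 ≤ sqNorm (wave n k) := by
  have hker : LinearMap.ker (Fintype.linearCombination ℝ (fun j => toVec (n j))) = ⊥ :=
    LinearMap.ker_eq_bot.2 hn.fintypeLinearCombination_injective
  obtain ⟨K, hK0, hK⟩ := LinearMap.exists_antilipschitzWith _ hker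
  have hK0' : (0 : ℝ) < K := hK0
  set D : ℝ := (b + 1) * K with hD
  have hDpos : 0 < D := by positivity
  refine ⟨(D ^ 2)⁻¹, by positivity, fun k => ?_⟩
  have h1 : ‖(fun j => (k j : ℝ))‖ ≤ K * ‖toVec (wave n k)‖ := by
    have := hK.le_mul_norm (map_zero _) (fun j => (k j : ℝ))
    rwa [Fintype.linearCombination_apply, ← toVec_wave] at this
  have h2 : l1Norm k ≤ D * ‖toVec (wave n k)‖ := by
    calc l1Norm k ≤ ∑ _j : Fin b, ‖(fun j => (k j : ℝ))‖ :=
          Finset.sum_le_sum fun j _ => norm_le_pi_norm (fun j => (k j : ℝ)) j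
      _ = b * ‖(fun j => (k j : ℝ))‖ := by simp
      _ ≤ (b + 1) * (K * ‖toVec (wave n k)‖) := by gcongr; linarith
      _ = D * ‖toVec (wave n k)‖ := by rw [hD]; ring
  rw [sqNorm_eq_norm_sq, inv_mul_le_iff₀ (by positivity), ← mul_pow]
  exact pow_le_pow_left₀ (l1Norm_nonneg k) h2 2

/-- The symbol of the linear operator on the mode `k`, at the linear frequencies. -/
def divisor {b d : ℕ} (n : Fin b → Fin d → ℤ) (ρ : ℝ) (k : Fin b → ℤ) : ℝ :=
  sqNorm (wave n k) + ρ - ∑ j, (k j : ℝ) * (sqNorm (n j) + ρ)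

theorem divisor_single {b d : ℕ} (n : Fin b → Fin d → ℤ) (ρ : ℝ) (j : Fin b) :
    divisor n ρ (Pi.single j 1) = 0 := by
  rw [divisor, wave_single, Finset.sum_eq_single j]
  · simp
  · intro i _ hi
    simp [Pi.single_eq_of_ne hi]
  · simp

/-- The divisor has the form `m ρ - l` with integers `m = 1 - ∑ k_j` and `l`. If `m ≠ 0` the
Diophantine condition excludes zero; if `m = 0`, a zero would make `k` a nontrivial resonant mode.
-/
theorem divisor_ne_zero {b d : ℕ} {n : Fin b → Fin d → ℤ} {ρ γ τ : ℝ} (hγ : 0 < γ)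
    (hρ : IsDiophantine ρ γ τ) (hK : nontrivialResonantModes n = ∅) {k : Fin b → ℤ}
    (hk : ∀ j, k ≠ Pi.single j 1) : divisor n ρ k ≠ 0 := by
  intro h0
  set m : ℤ := 1 - ∑ j, k j with hm
  set l : ℤ := ∑ j, k j * sqNorm (n j) - sqNorm (wave n k) with hl
  have hml : (m : ℝ) * ρ - l = 0 := by
    rw [← h0, hm, hl, divisor]
    push_cast
    simp only [mul_add, Finset.sum_add_distrib, ← Finset.sum_mul]
    ring
  by_cases hm0 : m = 0
  · rw [hm0] at hml
    have hl0 : l = 0 := by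
      have : (l : ℝ) = 0 := by linarith [show ((0 : ℤ) : ℝ) * ρ = 0 by simp]
      exact_mod_cast this
    have : k ∈ nontrivialResonantModes n :=
      ⟨⟨by omega, sub_eq_zero.1 hl0⟩, by rintro ⟨j, hj⟩; exact hk j hj.symm⟩
    rw [hK] at this
    exact this
  · have h1 := hρ m hm0 l
    rw [hml, abs_zero] at h1
    have : 0 < γ / |(m : ℝ)| ^ τ :=
      div_pos hγ (Real.rpow_pos_of_pos (abs_pos.2 (Int.cast_ne_zero.2 hm0)) _)
    linarith

theorem finite_l1Norm_lt {b : ℕ} (R : ℝ) : {k : Fin b → ℤ | l1Norm k < R}.Finite := by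
  refine (Set.finite_Icc (fun _ : Fin b => -⌈R⌉) (fun _ => ⌈R⌉)).subset fun k hk => ?_
  have h : ∀ j, |k j| ≤ ⌈R⌉ := fun j => by
    have h1 : ((|k j| : ℤ) : ℝ) ≤ (⌈R⌉ : ℝ) := by
      rw [Int.cast_abs]
      exact (abs_le_l1Norm k j).trans ((le_of_lt hk).trans (Int.le_ceil R))
    exact_mod_cast h1
  exact ⟨fun j => (abs_le.1 (h j)).1, fun j => (abs_le.1 (h j)).2⟩

/-- For large `k` the quadratic part dominates the affine remainder, and only finitely many `k` are
left. Zero divisors do no harm here, because the quotient is then `0` by convention. -/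
theorem exists_bound_div_divisor {b d : ℕ} {n : Fin b → Fin d → ℤ}
    (hn : LinearIndependent ℝ (fun j => toVec (n j))) (ρ : ℝ) :
    ∃ C : ℝ, 0 < C ∧ (∀ k, |(sqNorm (wave n k) : ℝ) / divisor n ρ k| ≤ C) ∧
      ∀ j k, |(k j : ℝ) / divisor n ρ k| ≤ C := by
  obtain ⟨c, hc, hQ⟩ := exists_mul_sq_le_sqNorm_wave hn
  set A : ℝ := |ρ| + ∑ j, |(sqNorm (n j) : ℝ) + ρ| with hA
  have hA0 : 0 ≤ A := add_nonneg (abs_nonneg _) (Finset.sum_nonneg fun _ _ => abs_nonneg _)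
  -- Beyond `R` the remainder, of size at most `A |k|₁`, is at most half of the quadratic part.
  set R : ℝ := max 1 (4 * A / c) with hR
  obtain ⟨C1, hC1⟩ := ((finite_l1Norm_lt (b := b) R).image
    (fun k => |(sqNorm (wave n k) : ℝ) / divisor n ρ k| + l1Norm k / |divisor n ρ k|)).bddAbove
  have key : ∀ k : Fin b → ℤ, |(sqNorm (wave n k) : ℝ) / divisor n ρ k| +
      l1Norm k / |divisor n ρ k| ≤ max C1 (2 + 2 / c) := by
    intro k
    by_cases hk : l1Norm k < R
    · exact (hC1 ⟨k, hk, rfl⟩).trans (le_max_left _ _)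
    refine le_trans ?_ (le_max_right _ _)
    have hS1 : 1 ≤ l1Norm k := (le_max_left _ _).trans (not_lt.1 hk)
    have hS2 : 4 * A ≤ l1Norm k * c :=
      (div_le_iff₀ hc).1 ((le_max_right _ _).trans (not_lt.1 hk))
    set S := l1Norm k with hS
    set Q : ℝ := (sqNorm (wave n k) : ℝ) with hQdef
    have hQk : c * S ^ 2 ≤ Q := hQ k
    have hQ0 : 0 < Q := lt_of_lt_of_le (by positivity) hQk
    have hrest : |ρ - ∑ j, (k j : ℝ) * (sqNorm (n j) + ρ)| ≤ A * S := by
      refine (abs_sub _ _).trans ?_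
      rw [hA, add_mul]
      refine add_le_add (le_mul_of_one_le_right (abs_nonneg _) hS1) ?_
      rw [Finset.sum_mul]
      refine (Finset.abs_sum_le_sum_abs _ _).trans (Finset.sum_le_sum fun j _ => ?_)
      rw [abs_mul, mul_comm]
      exact mul_le_mul_of_nonneg_left (abs_le_l1Norm k j) (abs_nonneg _)
    have hD : Q / 2 ≤ divisor n ρ k := by
      have h1 := (abs_le.1 hrest).1
      have h2 : divisor n ρ k = Q + (ρ - ∑ j, (k j : ℝ) * (sqNorm (n j) + ρ)) := by
        rw [divisor]; ring
      have h3 : A * S ≤ Q / 2 := by nlinarith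
      linarith
    have hD0 : 0 < divisor n ρ k := lt_of_lt_of_le (by positivity) hD
    rw [abs_of_pos (div_pos hQ0 hD0), abs_of_pos hD0]
    refine add_le_add ?_ ?_
    · rw [div_le_iff₀ hD0]; linarith
    · rw [div_le_div_iff₀ hD0 hc]
      have : S * c ≤ c * S ^ 2 := by nlinarith [mul_pos hc (lt_of_lt_of_le one_pos hS1)]
      linarith
  refine ⟨max C1 (2 + 2 / c), lt_of_lt_of_le (by positivity) (le_max_right _ _), fun k => ?_,
    fun j k => ?_⟩
  · exact (le_add_of_nonneg_right (div_nonneg (l1Norm_nonneg k) (abs_nonneg _))).trans (key k)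
  · refine le_trans ?_ ((le_add_of_nonneg_left (abs_nonneg _)).trans (key k))
    rw [abs_div]
    exact div_le_div_of_nonneg_right (abs_le_l1Norm k j) (abs_nonneg _)

/-! ### The nonlinearity and the contraction argument. -/

theorem exists_fixedPoint_closedBall {B : Type*} [NormedAddCommGroup B] [CompleteSpace B]
    {T : B → B} {ε : ℝ} (hε : 0 ≤ ε) (hmaps : ∀ v, ‖v‖ ≤ ε → ‖T v‖ ≤ ε)
    (hlip : ∀ v v', ‖v‖ ≤ ε → ‖v'‖ ≤ ε → ‖T v - T v'‖ ≤ 1 / 2 * ‖v - v'‖) :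
    ∃ v, ‖v‖ ≤ ε ∧ T v = v := by
  have hmaps' : Set.MapsTo T (Metric.closedBall 0 ε) (Metric.closedBall 0 ε) := fun v hv =>
    mem_closedBall_zero_iff.2 (hmaps v (mem_closedBall_zero_iff.1 hv))
  have hc : ContractingWith (1 / 2) (hmaps'.restrict T _ _) := by
    refine ⟨by norm_num, LipschitzWith.of_dist_le_mul fun v v' => ?_⟩
    rw [Subtype.dist_eq, Subtype.dist_eq, dist_eq_norm, dist_eq_norm]
    simpa using hlip v v' (mem_closedBall_zero_iff.1 v.2) (mem_closedBall_zero_iff.1 v'.2)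
  obtain ⟨v, hv, hT, -⟩ := hc.exists_fixedPoint' (Metric.isClosed_closedBall.isComplete) hmaps'
    (x := 0) (Metric.mem_closedBall_self hε) (edist_ne_top _ _)
  exact ⟨v, mem_closedBall_zero_iff.1 hv, hT⟩

theorem norm_mul_smul_le {B : Type*} [NormedAddCommGroup B] [NormedSpace ℝ B] {g x a p q : ℝ}
    {y : B} (hg : |g| ≤ a) (hx : |x| ≤ p) (hy : ‖y‖ ≤ q) : ‖(g * x) • y‖ ≤ a * p * q := by
  have ha : 0 ≤ a := (abs_nonneg g).trans hg
  have hp : 0 ≤ p := (abs_nonneg x).trans hx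
  rw [norm_smul, Real.norm_eq_abs, abs_mul]
  gcongr

section Nonlinearity

variable {B : Type*} [NormedCommRing B] [NormedAlgebra ℝ B]

/-- The nonlinearity `∂H/∂ū` in a Banach algebra with conjugation `J`. -/
def nonlinearity (α : ℕ → ℕ → ℝ) (J : B →L[ℝ] B) (u : B) : B :=
  (2 : ℝ) • (u ^ 2 * J u) + gradSeries α u (J u)

variable {J : B →L[ℝ] B}

theorem nonlinearity_zero {α : ℕ → ℕ → ℝ} (hα : IsAdmissible α) :
    nonlinearity α J 0 = 0 := by
  simp [nonlinearity, gradSeries_zero hα]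

variable [NormOneClass B]

theorem norm_cubic_sub_le (hJ : ∀ u, ‖J u‖ ≤ ‖u‖) {u u' : B} {s : ℝ} (hu : ‖u‖ ≤ s)
    (hu' : ‖u'‖ ≤ s) :
    ‖(2 : ℝ) • (u ^ 2 * J u) - (2 : ℝ) • (u' ^ 2 * J u')‖ ≤ 6 * s ^ 2 * ‖u - u'‖ := by
  have hδ' : ‖J u - J u'‖ ≤ ‖u - u'‖ := by rw [← map_sub]; exact hJ _
  have h := norm_monomial_sub_le hu ((hJ u).trans hu) hu' ((hJ u').trans hu') le_rfl hδ' 2 1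
  rw [pow_one, pow_one] at h
  rw [← smul_sub, norm_smul, Real.norm_ofNat]
  norm_num at h
  linarith

variable [CompleteSpace B]

theorem norm_gradSeries_reflect_sub_le {α : ℕ → ℕ → ℝ} (hα : IsAdmissible α) {r : ℝ} (hr : 0 < r)
    (hc : ConvergesOn α (4 * r)) (hJ : ∀ u, ‖J u‖ ≤ ‖u‖) {u u' : B} {s : ℝ} (hu : ‖u‖ ≤ s)
    (hu' : ‖u'‖ ≤ s) (hsr : s ≤ r) :
    ‖gradSeries α u (J u) - gradSeries α u' (J u')‖
      ≤ (∑' p, gradBound α r p) * (s ^ 3 * ‖u - u'‖) := by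
  have hδ' : ‖J u - J u'‖ ≤ ‖u - u'‖ := by rw [← map_sub]; exact hJ _
  exact norm_gradSeries_sub_le hα hr hc hu ((hJ u).trans hu) hu' ((hJ u').trans hu') hsr le_rfl hδ'

theorem norm_nonlinearity_sub_le {α : ℕ → ℕ → ℝ} (hα : IsAdmissible α) {r : ℝ} (hr : 0 < r)
    (hc : ConvergesOn α (4 * r)) (hJ : ∀ u, ‖J u‖ ≤ ‖u‖) {u u' : B} {s : ℝ} (hu : ‖u‖ ≤ s)
    (hu' : ‖u'‖ ≤ s) (hsr : s ≤ r) :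
    ‖nonlinearity α J u - nonlinearity α J u'‖
      ≤ (6 + (∑' p, gradBound α r p) * r) * s ^ 2 * ‖u - u'‖ := by
  have hs : 0 ≤ s := (norm_nonneg u).trans hu
  have h1 := norm_cubic_sub_le hJ hu hu'
  have h2 := norm_gradSeries_reflect_sub_le hα hr hc hJ hu hu' hsr
  have hK : 0 ≤ ∑' p, gradBound α r p := tsum_nonneg (gradBound_nonneg α hr)
  have h3 : (∑' p, gradBound α r p) * (s ^ 3 * ‖u - u'‖)
      ≤ (∑' p, gradBound α r p) * r * s ^ 2 * ‖u - u'‖ := by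
    calc _ = (∑' p, gradBound α r p) * s * s ^ 2 * ‖u - u'‖ := by ring
      _ ≤ _ := by gcongr
  rw [nonlinearity, nonlinearity, add_sub_add_comm]
  refine (norm_add_le _ _).trans ?_
  linarith

theorem norm_nonlinearity_le {α : ℕ → ℕ → ℝ} (hα : IsAdmissible α) {r : ℝ} (hr : 0 < r)
    (hc : ConvergesOn α (4 * r)) (hJ : ∀ u, ‖J u‖ ≤ ‖u‖) {u : B} {s : ℝ} (hu : ‖u‖ ≤ s)
    (hsr : s ≤ r) :
    ‖nonlinearity α J u‖ ≤ (6 + (∑' p, gradBound α r p) * r) * s ^ 3 := by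
  have hs : 0 ≤ s := (norm_nonneg u).trans hu
  have hK : 0 ≤ ∑' p, gradBound α r p := tsum_nonneg (gradBound_nonneg α hr)
  have h := norm_nonlinearity_sub_le hα hr hc hJ hu (u' := 0) (by simpa) hsr
  rw [nonlinearity_zero hα, sub_zero, sub_zero] at h
  calc _ ≤ _ := h
    _ ≤ (6 + (∑' p, gradBound α r p) * r) * s ^ 2 * s := by gcongr
    _ = _ := by ring

set_option maxHeartbeats 1000000 in
/-- Existence of small solutions of the fixed point equation to which the quasi-periodic ansatz
reduces. -/
theorem exists_small_solution {ι : Type*} [Fintype ι] {α : ℕ → ℕ → ℝ} (hα : IsAdmissible α)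
    {r : ℝ} (hr : 0 < r) (hc : ConvergesOn α (4 * r)) (hJ : ∀ u, ‖J u‖ ≤ ‖u‖)
    {M₀ : B →L[ℝ] B} {M : ι → B →L[ℝ] B} {φ : ι → B →L[ℝ] ℝ} {C₀ C₁ B₀ : ℝ}
    (hC₀ : 0 ≤ C₀) (hC₁ : 0 ≤ C₁) (hB₀ : 0 ≤ B₀) (hM₀ : ∀ x, ‖M₀ x‖ ≤ C₀ * ‖x‖)
    (hM : ∀ j x, ‖M j x‖ ≤ C₀ * ‖x‖) (hφ : ∀ j x, |φ j x| ≤ ‖x‖) :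
    ∃ K ε₀ : ℝ, 0 < K ∧ 0 < ε₀ ∧ ∀ ε, 0 < ε → ε < ε₀ → ∀ (u₀ : B) (g : ι → ℝ),
      ‖u₀‖ ≤ B₀ * ε → (∀ j, |g j| ≤ C₁ / ε) →
      ∃ v : B, M₀ (nonlinearity α J (u₀ + v))
          - ∑ j, (g j * φ j (nonlinearity α J (u₀ + v))) • M j v = v ∧
        ‖v‖ ≤ K * ε ^ 3 ∧ ‖u₀ + v‖ < r ∧ ‖nonlinearity α J (u₀ + v)‖ ≤ K * ε ^ 3 ∧
        ‖nonlinearity α J (u₀ + v) - (2 : ℝ) • (u₀ ^ 2 * J u₀)‖ ≤ K * ε ^ 4 := by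
  set Γ : ℝ := ∑' p, gradBound α r p with hΓdef
  have hΓ : 0 ≤ Γ := tsum_nonneg (gradBound_nonneg α hr)
  set K₁ : ℝ := 6 + Γ * r with hK₁
  have hK₁0 : 0 < K₁ := by positivity
  -- `u₀ + v` has norm at most `β ε` for every `v` in the ball of radius `ε`.
  set β : ℝ := B₀ + 1 with hβ
  have hβ0 : 0 < β := by positivity
  set N : ℝ := (Fintype.card ι : ℝ) with hN
  have hN0 : 0 ≤ N := Nat.cast_nonneg _
  -- The map has size `P ε³` on the ball, and Lipschitz constant `P' ε²`: the factor `1/ε` in `g` is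
  -- offset by `‖v‖ ≤ ε` or absorbed by the cubic size of the nonlinearity.
  set P : ℝ := C₀ * K₁ * β ^ 3 * (1 + N * C₁) with hP
  have hP0 : 0 ≤ P := by positivity
  set P' : ℝ := C₀ * K₁ * β ^ 2 * (1 + N * C₁ * (1 + β)) with hP'
  have hP'0 : 0 ≤ P' := by positivity
  set K : ℝ := 1 + P + K₁ * β ^ 3 + 6 * β ^ 2 * P + Γ * β ^ 4 with hK
  -- The last three thresholds ensure in turn convergence of the series, invariance of the ball, and
  -- contraction by one half.
  refine ⟨K, min 1 (min (r / (2 * β)) (min (1 / (P + 1)) (1 / (2 * (P' + 1))))), by positivity,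
    by positivity, fun ε hε hlt u₀ g hu₀ hg => ?_⟩
  obtain ⟨h1, h2, h3, h4⟩ : ε < 1 ∧ ε < r / (2 * β) ∧ ε < 1 / (P + 1) ∧ ε < 1 / (2 * (P' + 1)) := by
    simpa [lt_min_iff] using hlt
  have hsr : β * ε < r := by
    rw [lt_div_iff₀ (by positivity)] at h2
    nlinarith
  have hPε : P * ε ^ 2 ≤ 1 := by
    rw [lt_div_iff₀ (by positivity)] at h3
    have : P * ε ≤ 1 := by nlinarith
    nlinarith [mul_nonneg hP0 hε.le]
  have hP'ε : P' * ε ^ 2 ≤ 1 / 2 := by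
    rw [lt_div_iff₀ (by positivity)] at h4
    have : P' * ε ≤ 1 / 2 := by nlinarith
    nlinarith [mul_nonneg hP'0 hε.le]
  have hu : ∀ v : B, ‖v‖ ≤ ε → ‖u₀ + v‖ ≤ β * ε := fun v hv => by
    refine (norm_add_le _ _).trans ?_
    rw [hβ, add_mul, one_mul]
    exact add_le_add hu₀ hv
  have hF : ∀ v : B, ‖v‖ ≤ ε → ‖nonlinearity α J (u₀ + v)‖ ≤ K₁ * β ^ 3 * ε ^ 3 := fun v hv => by
    refine (norm_nonlinearity_le hα hr hc hJ (hu v hv) hsr.le).trans_eq ?_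
    rw [mul_pow, mul_assoc]
  have hFl : ∀ v v' : B, ‖v‖ ≤ ε → ‖v'‖ ≤ ε →
      ‖nonlinearity α J (u₀ + v) - nonlinearity α J (u₀ + v')‖ ≤ K₁ * β ^ 2 * ε ^ 2 * ‖v - v'‖ :=
    fun v v' hv hv' => by
    refine (norm_nonlinearity_sub_le hα hr hc hJ (hu v hv) (hu v' hv') hsr.le).trans_eq ?_
    rw [mul_pow, add_sub_add_left_eq_sub]
    ring
  have hT : ∀ v : B, ‖v‖ ≤ ε → ‖M₀ (nonlinearity α J (u₀ + v))
      - ∑ j, (g j * φ j (nonlinearity α J (u₀ + v))) • M j v‖ ≤ P * ε ^ 3 := by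
    intro v hv
    have e1 : ‖M₀ (nonlinearity α J (u₀ + v))‖ ≤ C₀ * (K₁ * β ^ 3 * ε ^ 3) :=
      (hM₀ _).trans (mul_le_mul_of_nonneg_left (hF v hv) hC₀)
    have e2 : ∀ j, ‖(g j * φ j (nonlinearity α J (u₀ + v))) • M j v‖
        ≤ C₁ / ε * (K₁ * β ^ 3 * ε ^ 3) * (C₀ * ε) := fun j =>
      norm_mul_smul_le (hg j) ((hφ j _).trans (hF v hv))
        ((hM j v).trans (mul_le_mul_of_nonneg_left hv hC₀))
    have e3 : ‖∑ j, (g j * φ j (nonlinearity α J (u₀ + v))) • M j v‖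
        ≤ N * (C₁ / ε * (K₁ * β ^ 3 * ε ^ 3) * (C₀ * ε)) := by
      refine (norm_sum_le_of_le _ fun j _ => e2 j).trans_eq ?_
      rw [Finset.sum_const, Finset.card_univ, nsmul_eq_mul]
    refine (norm_sub_le _ _).trans ((add_le_add e1 e3).trans_eq ?_)
    rw [hP]
    field_simp
  obtain ⟨v, hv, hfix⟩ := exists_fixedPoint_closedBall (ε := ε)
    (T := fun v => M₀ (nonlinearity α J (u₀ + v))
      - ∑ j, (g j * φ j (nonlinearity α J (u₀ + v))) • M j v) hε.le
    (fun v hv => (hT v hv).trans (by nlinarith)) (fun v v' hv hv' => by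
      have e1 : ‖M₀ (nonlinearity α J (u₀ + v)) - M₀ (nonlinearity α J (u₀ + v'))‖
          ≤ C₀ * (K₁ * β ^ 2 * ε ^ 2 * ‖v - v'‖) := by
        rw [← map_sub]
        exact (hM₀ _).trans (mul_le_mul_of_nonneg_left (hFl v v' hv hv') hC₀)
      have e2 : ∀ j, ‖(g j * φ j (nonlinearity α J (u₀ + v))) • M j v
          - (g j * φ j (nonlinearity α J (u₀ + v'))) • M j v'‖
          ≤ C₁ / ε * (K₁ * β ^ 2 * ε ^ 2 * ‖v - v'‖) * (C₀ * ε)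
            + C₁ / ε * (K₁ * β ^ 3 * ε ^ 3) * (C₀ * ‖v - v'‖) := fun j => by
        have e : (g j * φ j (nonlinearity α J (u₀ + v))) • M j v
            - (g j * φ j (nonlinearity α J (u₀ + v'))) • M j v'
            = (g j * φ j (nonlinearity α J (u₀ + v) - nonlinearity α J (u₀ + v'))) • M j v
              + (g j * φ j (nonlinearity α J (u₀ + v'))) • M j (v - v') := by
          rw [map_sub, map_sub]
          module
        rw [e]
        exact (norm_add_le _ _).trans (add_le_add
          (norm_mul_smul_le (hg j) ((hφ j _).trans (hFl v v' hv hv'))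
            ((hM j v).trans (mul_le_mul_of_nonneg_left hv hC₀)))
          (norm_mul_smul_le (hg j) ((hφ j _).trans (hF v' hv')) (hM j _)))
      have e3 : ‖∑ j, ((g j * φ j (nonlinearity α J (u₀ + v))) • M j v
          - (g j * φ j (nonlinearity α J (u₀ + v'))) • M j v')‖
          ≤ N * (C₁ / ε * (K₁ * β ^ 2 * ε ^ 2 * ‖v - v'‖) * (C₀ * ε)
            + C₁ / ε * (K₁ * β ^ 3 * ε ^ 3) * (C₀ * ‖v - v'‖)) := by
        refine (norm_sum_le_of_le _ fun j _ => e2 j).trans_eq ?_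
        rw [Finset.sum_const, Finset.card_univ, nsmul_eq_mul]
      rw [sub_sub_sub_comm, ← Finset.sum_sub_distrib]
      refine (norm_sub_le _ _).trans ((add_le_add e1 e3).trans ?_)
      have e4 : C₀ * (K₁ * β ^ 2 * ε ^ 2 * ‖v - v'‖)
          + N * (C₁ / ε * (K₁ * β ^ 2 * ε ^ 2 * ‖v - v'‖) * (C₀ * ε)
            + C₁ / ε * (K₁ * β ^ 3 * ε ^ 3) * (C₀ * ‖v - v'‖)) = P' * ε ^ 2 * ‖v - v'‖ := by
        rw [hP']
        field_simp
      rw [e4]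
      exact mul_le_mul_of_nonneg_right hP'ε (norm_nonneg _))
  -- The fixed point was sought only in the ball of radius `ε`, but lies in the image of the map,
  -- which is cubically small.
  have hv3 : ‖v‖ ≤ P * ε ^ 3 := by
    have := hT v hv
    rwa [show _ = v from hfix] at this
  have hPK : P ≤ K := by
    have : 0 ≤ 1 + K₁ * β ^ 3 + 6 * β ^ 2 * P + Γ * β ^ 4 := by positivity
    linarith
  have hKK : K₁ * β ^ 3 ≤ K := by
    have : 0 ≤ 1 + P + 6 * β ^ 2 * P + Γ * β ^ 4 := by positivity
    linarith
  refine ⟨v, hfix, hv3.trans (by gcongr), (hu v hv).trans_lt hsr, (hF v hv).trans (by gcongr), ?_⟩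
  have hu₀' : ‖u₀‖ ≤ β * ε := by
    refine hu₀.trans ?_
    rw [hβ]
    nlinarith
  -- The error beyond the cubic term at `u₀` has two parts: replacing `u₀` by `u₀ + v` costs `ε² ·
  -- ε³`, and the higher series costs `ε⁴`.
  have e1 := norm_cubic_sub_le hJ (hu v hv) hu₀'
  rw [add_sub_cancel_left] at e1
  have e2 := norm_gradSeries_reflect_sub_le hα hr hc hJ (hu v hv) (u' := 0)
    (by rw [norm_zero]; positivity) hsr.le
  rw [map_zero, gradSeries_zero hα, sub_zero, sub_zero] at e2
  rw [nonlinearity, add_sub_right_comm]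
  refine (norm_add_le _ _).trans ((add_le_add e1 e2).trans ?_)
  calc 6 * (β * ε) ^ 2 * ‖v‖ + Γ * ((β * ε) ^ 3 * ‖u₀ + v‖)
      ≤ 6 * (β * ε) ^ 2 * (P * ε ^ 3) + Γ * ((β * ε) ^ 3 * (β * ε)) := by
        gcongr
        exact hu v hv
    _ = (6 * β ^ 2 * P * ε + Γ * β ^ 4) * ε ^ 4 := by ring
    _ ≤ K * ε ^ 4 := by
        gcongr
        have a1 : 6 * β ^ 2 * P * ε ≤ 6 * β ^ 2 * P := mul_le_of_le_one_right (by positivity) h1.le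
        have a2 : 0 ≤ 1 + P + K₁ * β ^ 3 := by positivity
        linarith

end Nonlinearity

open WeightedL1

/-! ### From coefficients to functions of space and time. -/

section Modes

variable {b d : ℕ} (ω : EuclideanSpace ℝ (Fin b)) (n : Fin b → Fin d → ℤ)

/-- The linear form `x ↦ m · x`. -/
def spaceForm (m : Fin d → ℤ) : EuclideanSpace ℝ (Fin d) →L[ℝ] ℝ := innerSL ℝ (toVec m)

theorem spaceForm_apply (m : Fin d → ℤ) (x : EuclideanSpace ℝ (Fin d)) :
    spaceForm m x = ∑ i, (m i : ℝ) * x i := by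
  simp [spaceForm, toVec, PiLp.inner_apply, mul_comm]

theorem norm_spaceForm (m : Fin d → ℤ) : ‖spaceForm m‖ = ‖toVec m‖ :=
  innerSL_apply_norm ℝ _

/-- The character of `ℤ^b` at the space-time point `(t, x)`. -/
def character (t : ℝ) (x : EuclideanSpace ℝ (Fin d)) (k : Fin b → ℤ) : ℂ :=
  mode ω (wave n k) k t x

theorem character_eq (t : ℝ) (x : EuclideanSpace ℝ (Fin d)) (k : Fin b → ℤ) :
    character ω n t x k = Complex.exp (Complex.I *
      ((spaceForm (wave n k) x + (∑ j, (k j : ℝ) * ω j) * t : ℝ) : ℂ)) := by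
  rw [spaceForm_apply]
  rfl

theorem norm_character (t : ℝ) (x : EuclideanSpace ℝ (Fin d)) (k : Fin b → ℤ) :
    ‖character ω n t x k‖ = 1 := norm_exp_I_mul _

theorem character_add (t : ℝ) (x : EuclideanSpace ℝ (Fin d)) (k l : Fin b → ℤ) :
    character ω n t x (k + l) = character ω n t x k * character ω n t x l := by
  rw [character, character, character, mode, mode, mode, ← Complex.exp_add, ← mul_add, wave_add,
    ← Complex.ofReal_add]
  congr 3
  simp only [Pi.add_apply, Int.cast_add, add_mul, Finset.sum_add_distrib]
  ring

theorem character_zero (t : ℝ) (x : EuclideanSpace ℝ (Fin d)) : character ω n t x 0 = 1 := by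
  simp [character, mode, wave]

theorem character_neg (t : ℝ) (x : EuclideanSpace ℝ (Fin d)) (k : Fin b → ℤ) :
    character ω n t x (-k) = starRingEnd ℂ (character ω n t x k) := by
  have h1 : character ω n t x (-k) * character ω n t x k = 1 := by
    rw [← character_add, neg_add_cancel, character_zero]
  rw [eq_inv_of_mul_eq_one_left h1, Complex.inv_def, Complex.normSq_eq_norm_sq, norm_character]
  simp

theorem character_add_period (t : ℝ) (x : EuclideanSpace ℝ (Fin d)) (i : Fin d)
    (k : Fin b → ℤ) :
    character ω n t (x + EuclideanSpace.single i (2 * Real.pi)) k = character ω n t x k := by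
  have h : spaceForm (wave n k) (EuclideanSpace.single i (2 * Real.pi))
      = wave n k i * (2 * Real.pi) := by
    rw [spaceForm_apply, Finset.sum_eq_single i]
    · simp
    · intro j _ hj
      simp [hj]
    · simp
  rw [character_eq, character_eq, map_add, h, Complex.exp_eq_exp_iff_exists_int]
  refine ⟨wave n k i, ?_⟩
  push_cast
  ring

/-- The function on space-time with given Fourier coefficients. -/
def synth {W : Weight (Fin b → ℤ)} (u : WeightedL1 W) (t : ℝ) (x : EuclideanSpace ℝ (Fin d)) : ℂ :=
  eval W (character ω n t x) (norm_character ω n t x) u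

variable {W : Weight (Fin b → ℤ)}

theorem hasSum_synth (u : WeightedL1 W) (t : ℝ) (x : EuclideanSpace ℝ (Fin d)) :
    HasSum (fun k => (coeff u k : ℂ) * character ω n t x k) (synth ω n u t x) :=
  hasSum_eval _ u

theorem norm_synth_le (u : WeightedL1 W) (t : ℝ) (x : EuclideanSpace ℝ (Fin d)) :
    ‖synth ω n u t x‖ ≤ ‖u‖ :=
  norm_eval_le _ u

theorem synth_add_period (u : WeightedL1 W) (t : ℝ) (x : EuclideanSpace ℝ (Fin d)) (i : Fin d) :
    synth ω n u t (x + EuclideanSpace.single i (2 * Real.pi)) = synth ω n u t x := by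
  refine (hasSum_synth ω n u t _).unique ?_
  simp only [character_add_period]
  exact hasSum_synth ω n u t x

/-- Evaluation at `(t, x)` is a continuous algebra homomorphism that intertwines reflection with
conjugation, so it commutes with the power series. -/
theorem dHbar_synth {α : ℕ → ℕ → ℝ} (hα : IsAdmissible α) {r : ℝ} (hr : 0 < r)
    (hc : ConvergesOn α (4 * r)) {u : WeightedL1 W} (hu : ‖u‖ < r) (t : ℝ)
    (x : EuclideanSpace ℝ (Fin d)) :
    dHbar α (synth ω n u t x) = synth ω n (nonlinearity α (reflect W) u) t x := by
  have hmul : ∀ u v : WeightedL1 W, synth ω n (u * v) t x = synth ω n u t x * synth ω n v t x :=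
    eval_mul (norm_character ω n t x) (character_add ω n t x)
  have hrefl : synth ω n (reflect W u) t x = starRingEnd ℂ (synth ω n u t x) :=
    eval_reflect (norm_character ω n t x) (character_neg ω n t x) u
  rw [dHbar_eq hα hr hc ((norm_synth_le ω n u t x).trans_lt hu), nonlinearity]
  have h1 : synth ω n (gradSeries α u (reflect W u)) t x
      = gradSeries α (synth ω n u t x) (starRingEnd ℂ (synth ω n u t x)) := by
    rw [← hrefl]
    exact map_gradSeries hα hr hc hu.le ((norm_reflect_le u).trans hu.le)
      (eval W (character ω n t x) (norm_character ω n t x))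
      (eval_one _ (character_zero ω n t x)) hmul
  have h2 : synth ω n ((2 : ℝ) • (u ^ 2 * reflect W u)) t x
      = 2 * (synth ω n u t x * synth ω n u t x * starRingEnd ℂ (synth ω n u t x)) := by
    rw [← hrefl, ← hmul, ← hmul, pow_two]
    refine (map_smul (eval W (character ω n t x) (norm_character ω n t x)) (2 : ℝ) _).trans ?_
    rw [Complex.real_smul, Complex.ofReal_ofNat]
    rfl
  rw [← h1, ← h2]
  exact (map_add (eval W (character ω n t x) (norm_character ω n t x)) _ _).symm

end Modes

/-! ### Regularity, and the equation mode by mode. -/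

section Regularity

variable {b d : ℕ} (ω : EuclideanSpace ℝ (Fin b)) (n : Fin b → Fin d → ℤ) {M : ℝ} {hM : 0 ≤ M}

theorem l1Norm_le_expWeight (hM1 : 1 ≤ M) (k : Fin b → ℤ) : l1Norm k ≤ expWeight b M hM k := by
  have h0 := l1Norm_nonneg k
  calc l1Norm k ≤ Real.exp (l1Norm k) := by linarith [Real.add_one_le_exp (l1Norm k)]
    _ ≤ Real.exp (M * l1Norm k) := Real.exp_le_exp.2 (le_mul_of_one_le_left h0 hM1)

theorem l1Norm_sq_le_expWeight (hM2 : 2 ≤ M) (k : Fin b → ℤ) :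
    l1Norm k ^ 2 ≤ expWeight b M hM k := by
  have h0 := l1Norm_nonneg k
  calc l1Norm k ^ 2 ≤ Real.exp (l1Norm k) ^ 2 :=
        pow_le_pow_left₀ h0 (by linarith [Real.add_one_le_exp (l1Norm k)]) 2
    _ = Real.exp (2 * l1Norm k) := by rw [← Real.exp_nat_mul]; norm_num
    _ ≤ Real.exp (M * l1Norm k) := Real.exp_le_exp.2 (mul_le_mul_of_nonneg_right hM2 h0)

/-- Each derivative costs a factor `|k|₁`; the exponential weight with `2 ≤ M` pays for two. -/
theorem summable_norm_mul_coeff {V : Type*} [NormedAddCommGroup V] [NormedSpace ℝ V]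
    (hM2 : 2 ≤ M) (u : WeightedL1 (expWeight b M hM)) {L : (Fin b → ℤ) → V →L[ℝ] ℝ} {A : ℝ}
    (hL : ∀ k, ‖L k‖ ≤ A * l1Norm k) {c : (Fin b → ℤ) → ℂ} (hc : ∀ k, ‖c k‖ = |coeff u k|) :
    (Summable fun k => ‖c k‖) ∧ (Summable fun k => ‖L k‖ * ‖c k‖) ∧
      Summable fun k => ‖L k‖ * (‖L k‖ * ‖c k‖) := by
  have hs := (hasSum_norm u).summable
  refine ⟨hs.of_nonneg_of_le (fun _ => norm_nonneg _) fun k => ?_,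
    (hs.mul_left |A|).of_nonneg_of_le (fun _ => by positivity) fun k => ?_,
    (hs.mul_left (A ^ 2)).of_nonneg_of_le (fun _ => by positivity) fun k => ?_⟩
  · rw [hc]
    exact le_mul_of_one_le_right (abs_nonneg _) (Weight.one_le _ k)
  · have h1 := l1Norm_le_expWeight (hM := hM) (by linarith) k
    have h2 : ‖L k‖ ≤ |A| * expWeight b M hM k :=
      (hL k).trans (mul_le_mul (le_abs_self A) h1 (l1Norm_nonneg k) (abs_nonneg A))
    rw [hc]
    calc ‖L k‖ * |coeff u k| ≤ |A| * expWeight b M hM k * |coeff u k| := by gcongr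
      _ = _ := by ring
  · have h1 := l1Norm_sq_le_expWeight (hM := hM) hM2 k
    have h2 : ‖L k‖ ^ 2 ≤ A ^ 2 * expWeight b M hM k := by
      refine (pow_le_pow_left₀ (norm_nonneg _) (hL k) 2).trans ?_
      rw [mul_pow]
      gcongr
    rw [hc, ← mul_assoc, ← pow_two]
    calc ‖L k‖ ^ 2 * |coeff u k| ≤ A ^ 2 * expWeight b M hM k * |coeff u k| := by gcongr
      _ = _ := by ring

theorem abs_frequency_le (k : Fin b → ℤ) :
    |∑ j, (k j : ℝ) * ω j| ≤ (∑ j, |ω j|) * l1Norm k := by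
  rw [Finset.sum_mul]
  refine (Finset.abs_sum_le_sum_abs _ _).trans (Finset.sum_le_sum fun j _ => ?_)
  rw [abs_mul, mul_comm]
  exact mul_le_mul_of_nonneg_left (abs_le_l1Norm k j) (abs_nonneg _)

theorem contDiff_synth (hM2 : 2 ≤ M) (u : WeightedL1 (expWeight b M hM)) :
    ContDiff ℝ 2 (fun p : ℝ × EuclideanSpace ℝ (Fin d) => synth ω n u p.1 p.2) := by
  set L : (Fin b → ℤ) → (ℝ × EuclideanSpace ℝ (Fin d)) →L[ℝ] ℝ := fun k =>
    (spaceForm (wave n k)).comp (ContinuousLinearMap.snd ℝ ℝ _)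
      + (∑ j, (k j : ℝ) * ω j) • ContinuousLinearMap.fst ℝ ℝ _ with hLdef
  have hL : ∀ k, ‖L k‖ ≤ ((∑ j, ‖toVec (n j)‖) + ∑ j, |ω j|) * l1Norm k := fun k => by
    rw [add_mul]
    refine (norm_add_le _ _).trans (add_le_add ?_ ?_)
    · refine (ContinuousLinearMap.opNorm_comp_le _ _).trans ?_
      rw [norm_spaceForm]
      exact (mul_le_of_le_one_right (norm_nonneg _) (ContinuousLinearMap.norm_snd_le _ _ _)).trans
        (norm_toVec_wave_le n k)
    · rw [norm_smul, Real.norm_eq_abs]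
      exact (mul_le_of_le_one_right (abs_nonneg _) (ContinuousLinearMap.norm_fst_le _ _ _)).trans
        (abs_frequency_le ω k)
  obtain ⟨h0, h1, h2⟩ := summable_norm_mul_coeff hM2 u hL (c := fun k => (coeff u k : ℂ))
    (fun k => by rw [Complex.norm_real, Real.norm_eq_abs])
  have he : (fun p : ℝ × EuclideanSpace ℝ (Fin d) => synth ω n u p.1 p.2)
      = expSum L fun k => (coeff u k : ℂ) := funext fun p => by
    refine (hasSum_synth ω n u p.1 p.2).tsum_eq.symm.trans (tsum_congr fun k => ?_)
    rw [character_eq, smul_eq_mul, mul_comm]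
    rfl
  rw [he]
  exact contDiff_two_expSum h0 h1 h2

theorem hasSum_laplacian_synth (hM2 : 2 ≤ M) (u : WeightedL1 (expWeight b M hM)) (t : ℝ)
    (x : EuclideanSpace ℝ (Fin d)) :
    HasSum (fun k => -((sqNorm (wave n k) : ℝ) : ℂ) * coeff u k * character ω n t x k)
      (Laplacian.laplacian (synth ω n u t) x) := by
  set L : (Fin b → ℤ) → EuclideanSpace ℝ (Fin d) →L[ℝ] ℝ := fun k => spaceForm (wave n k)
  -- At fixed time the phase in `t` is absorbed into the coefficients, leaving an exponential sum in
  -- `x` alone.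
  set c : (Fin b → ℤ) → ℂ := fun k =>
    coeff u k * Complex.exp (Complex.I * ((∑ j, (k j : ℝ) * ω j) * t : ℝ)) with hc
  obtain ⟨h0, h1, h2⟩ := summable_norm_mul_coeff hM2 u (L := L) (c := c)
    (fun k => (norm_spaceForm _).trans_le (norm_toVec_wave_le n k))
    (fun k => by rw [hc, norm_mul, norm_exp_I_mul, Complex.norm_real, Real.norm_eq_abs, mul_one])
  have hchar : ∀ k y, Complex.exp (Complex.I * (L k y : ℝ)) * c k
      = coeff u k * character ω n t y k := fun k y => by
    rw [character_eq, hc, Complex.ofReal_add, mul_add, Complex.exp_add]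
    ring
  have he : synth ω n u t = expSum L c := funext fun y => by
    refine (hasSum_synth ω n u t y).tsum_eq.symm.trans (tsum_congr fun k => ?_)
    rw [smul_eq_mul, hchar]
  have hsq : ∀ k, (∑ j, (L k (EuclideanSpace.single j 1) : ℂ) ^ 2)
      = ((sqNorm (wave n k) : ℝ) : ℂ) := fun k => by
    simp [L, spaceForm_apply, sqNorm]
  rw [he, laplacian_expSum h0 h1 h2]
  simp only [hsq]
  have hsum : Summable fun k => ‖-((sqNorm (wave n k) : ℝ) : ℂ) • c k‖ := by
    convert h2 using 2 with k
    rw [norm_smul, norm_neg, Complex.norm_real, Real.norm_eq_abs, norm_spaceForm, ← mul_assoc,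
      ← pow_two, sqNorm_eq_norm_sq, abs_of_nonneg (by positivity)]
  refine (summable_exp_smul L hsum x).hasSum.congr_fun ?_
  intro k
  rw [smul_eq_mul, smul_eq_mul, mul_left_comm, hchar]
  ring

theorem hasSum_deriv_synth (hM2 : 2 ≤ M) (u : WeightedL1 (expWeight b M hM)) (t : ℝ)
    (x : EuclideanSpace ℝ (Fin d)) :
    HasSum (fun k => ((∑ j, (k j : ℝ) * ω j : ℝ) : ℂ) * Complex.I * coeff u k *
      character ω n t x k) (deriv (fun s => synth ω n u s x) t) := by
  set L : (Fin b → ℤ) → ℝ →L[ℝ] ℝ := fun k =>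
    (∑ j, (k j : ℝ) * ω j) • ContinuousLinearMap.id ℝ ℝ with hLdef
  set c : (Fin b → ℤ) → ℂ := fun k =>
    coeff u k * Complex.exp (Complex.I * (spaceForm (wave n k) x : ℝ)) with hc
  have hLn : ∀ k, ‖L k‖ = |∑ j, (k j : ℝ) * ω j| := fun k => by
    rw [hLdef, norm_smul, ContinuousLinearMap.norm_id, mul_one, Real.norm_eq_abs]
  obtain ⟨h0, h1, -⟩ := summable_norm_mul_coeff hM2 u (L := L) (c := c)
    (fun k => (hLn k).trans_le (abs_frequency_le ω k))
    (fun k => by rw [hc, norm_mul, norm_exp_I_mul, Complex.norm_real, Real.norm_eq_abs, mul_one])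
  have hchar : ∀ k s, Complex.exp (Complex.I * (L k s : ℝ)) * c k
      = coeff u k * character ω n s x k := fun k s => by
    have : L k s = (∑ j, (k j : ℝ) * ω j) * s := rfl
    rw [this, character_eq, hc, Complex.ofReal_add, mul_add, Complex.exp_add]
    ring
  have he : (fun s => synth ω n u s x) = expSum L c := funext fun s => by
    refine (hasSum_synth ω n u s x).tsum_eq.symm.trans (tsum_congr fun k => ?_)
    rw [smul_eq_mul, hchar]
  have hL1 : ∀ k, L k 1 = ∑ j, (k j : ℝ) * ω j := fun k => mul_one _
  rw [he, deriv_expSum h0 h1]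
  simp only [hL1]
  have hsum : Summable fun k =>
      ‖(((∑ j, (k j : ℝ) * ω j : ℝ) : ℂ) * Complex.I) • c k‖ := by
    convert h1 using 2 with k
    rw [norm_smul, norm_mul, Complex.norm_I, mul_one, Complex.norm_real, Real.norm_eq_abs, hLn]
  refine (summable_exp_smul L hsum t).hasSum.congr_fun ?_
  intro k
  rw [smul_eq_mul, smul_eq_mul, mul_left_comm, hchar]
  ring

/-- Coefficients satisfying the algebraic equation on each mode give a classical solution. -/
theorem isSolution_synth {α : ℕ → ℕ → ℝ} (hα : IsAdmissible α) {r : ℝ} (hr : 0 < r)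
    (hc : ConvergesOn α (4 * r)) (hM2 : 2 ≤ M) {u : WeightedL1 (expWeight b M hM)} (hu : ‖u‖ < r)
    {ρ : ℝ} (heq : ∀ k, (sqNorm (wave n k) + ρ - ∑ j, (k j : ℝ) * ω j) * coeff u k
      = sqNorm (wave n k) * coeff (nonlinearity α (reflect _) u) k) :
    IsSolution α ρ (synth ω n u : ℝ → EuclideanSpace ℝ (Fin d) → ℂ) where
  periodic t x i := synth_add_period ω n u t x i
  contDiff := contDiff_synth ω n hM2 u
  mem_domain := ⟨4 * r, hc, fun t x => (norm_synth_le ω n u t x).trans_lt (by linarith)⟩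
  equation t x := by
    simp only [dHbar_synth ω n hα hr hc hu]
    have h1 := (hasSum_deriv_synth ω n hM2 u t x).mul_left Complex.I
    have h2 := hasSum_laplacian_synth ω n hM2 u t x
    have h3 := (hasSum_synth ω n u t x).mul_left (ρ : ℂ)
    have h4 := hasSum_laplacian_synth ω n hM2 (nonlinearity α (reflect _) u) t x
    refine (((h1.sub h2).add h3).add h4).unique ?_
    refine hasSum_zero.congr_fun fun k => ?_
    have hk := congrArg (fun y : ℝ => (y : ℂ)) (heq k)
    simp only [Complex.ofReal_mul, Complex.ofReal_add, Complex.ofReal_sub] at hk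
    linear_combination character ω n t x k * hk
      + ((∑ j, (k j : ℝ) * ω j : ℝ) : ℂ) * coeff u k * character ω n t x k * Complex.I_mul_I

end Regularity

/-! ### The remainder norm and the explicit cubic coefficient. -/

theorem rpow_le_mul_exp {s x : ℝ} (hs : 0 < s) (hx : 0 ≤ x) : x ^ s ≤ s ^ s * Real.exp x := by
  have h1 : x ≤ s * Real.exp (x / s) := by
    have h := Real.add_one_le_exp (x / s)
    calc x = s * (x / s) := by field_simp
      _ ≤ s * Real.exp (x / s) := mul_le_mul_of_nonneg_left (by linarith) hs.le
  calc x ^ s ≤ (s * Real.exp (x / s)) ^ s := Real.rpow_le_rpow hx h1 hs.le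
    _ = s ^ s * Real.exp x := by
      rw [Real.mul_rpow hs.le (Real.exp_nonneg _), ← Real.exp_mul, div_mul_cancel₀ _ hs.ne']

/-- The embedding of `ℓ¹` into `ℓ²`: each `y i` is at most the total `Y`, so `y i ^ 2 ≤ Y * y i`. -/
theorem summable_sq_and_sqrt_tsum_le {ι : Type*} {f y : ι → ℝ} {Y : ℝ} (hy : HasSum y Y)
    (hy0 : ∀ i, 0 ≤ y i) (hf0 : ∀ i, 0 ≤ f i) (hf : ∀ i, f i ≤ y i ^ 2) :
    Summable f ∧ Real.sqrt (∑' i, f i) ≤ Y := by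
  have hY : ∀ i, y i ≤ Y := fun i => le_hasSum hy i fun j _ => hy0 j
  have hfY : ∀ i, f i ≤ Y * y i := fun i => (hf i).trans (by
    rw [pow_two]
    exact mul_le_mul_of_nonneg_right (hY i) (hy0 i))
  have hs : Summable f := (hy.mul_left Y).summable.of_nonneg_of_le hf0 hfY
  refine ⟨hs, Real.sqrt_le_iff.2 ⟨hy.nonneg hy0, ?_⟩⟩
  rw [pow_two]
  exact hasSum_le hfY hs.hasSum (hy.mul_left Y)

section Coefficients

variable {b d : ℕ} (n : Fin b → Fin d → ℤ) {W : Weight (Fin b → ℤ)}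

/-- The Fourier coefficients on `ℤ^d × ℤ^b`, supported on the indices `(∑ k_j n_j, k)`. -/
def waveCoeff (u : WeightedL1 W) (p : (Fin d → ℤ) × (Fin b → ℤ)) : ℂ :=
  if p.1 = wave n p.2 then (coeff u p.2 : ℂ) else 0

theorem wave_graph_injective : Function.Injective fun k : Fin b → ℤ => (wave n k, k) :=
  fun _ _ h => (Prod.ext_iff.1 h).2

theorem waveCoeff_wave (u : WeightedL1 W) (k : Fin b → ℤ) :
    waveCoeff n u (wave n k, k) = coeff u k := if_pos rfl

theorem waveCoeff_eq_zero (u : WeightedL1 W) {p : (Fin d → ℤ) × (Fin b → ℤ)}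
    (hp : p ∉ Set.range fun k : Fin b → ℤ => (wave n k, k)) : waveCoeff n u p = 0 :=
  if_neg fun h => hp ⟨p.2, Prod.ext h.symm rfl⟩

theorem hasSum_waveCoeff (ω : EuclideanSpace ℝ (Fin b)) (u : WeightedL1 W) (t : ℝ)
    (x : EuclideanSpace ℝ (Fin d)) :
    HasSum (fun p => waveCoeff n u p * mode ω p.1 p.2 t x) (synth ω n u t x) := by
  rw [← (wave_graph_injective n).hasSum_iff fun p hp => by
    rw [waveCoeff_eq_zero n u hp, zero_mul]]
  refine (hasSum_synth ω n u t x).congr_fun fun k => ?_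
  rw [Function.comp_apply, waveCoeff_wave]
  rfl

theorem remainderTerm_nonneg (σ s : ℝ) (c : (Fin d → ℤ) × (Fin b → ℤ) → ℂ)
    (p : (Fin d → ℤ) × (Fin b → ℤ)) : 0 ≤ remainderTerm n σ s c p := by
  unfold remainderTerm
  split_ifs
  · exact le_rfl
  · have : 0 ≤ idxNorm p := Real.sqrt_nonneg _
    positivity

/-- The polynomial weight is absorbed by one more unit of exponential rate, at the price of `s ^ s`,
which explains `σ + 1`. The other factor in the bound for `M` converts `|(w, k)|` into `|k|₁`. -/
theorem remainder_bound {σ s M : ℝ} (hσ : 0 < σ) (hs : 0 < s) (hM : 0 ≤ M)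
    (hM' : (σ + 1) * ((∑ j, ‖toVec (n j)‖) + 1) ≤ M) {u v : WeightedL1 (expWeight b M hM)}
    (huv : ∀ k, (∀ j, k ≠ Pi.single j 1) → coeff u k = coeff v k) :
    Summable (remainderTerm n σ s (waveCoeff n u)) ∧
      Real.sqrt (∑' p, remainderTerm n σ s (waveCoeff n u) p) ≤ s ^ s * ‖v‖ := by
  have hsupp : ∀ p ∉ Set.range (fun k : Fin b → ℤ => (wave n k, k)),
      remainderTerm n σ s (waveCoeff n u) p = 0 := fun p hp => by
    unfold remainderTerm
    split_ifs
    · rfl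
    · rw [waveCoeff_eq_zero n u hp]; simp
  have hbound : ∀ k : Fin b → ℤ, remainderTerm n σ s (waveCoeff n u) (wave n k, k)
      ≤ (s ^ s * (|coeff v k| * expWeight b M hM k)) ^ 2 := fun k => by
    unfold remainderTerm
    split_ifs with h
    · positivity
    have hk : ∀ j, k ≠ Pi.single j 1 := fun j hj => h ⟨j, by rw [hj, wave_single]⟩
    set I := idxNorm (wave n k, k) with hI
    have hI0 : 0 ≤ I := Real.sqrt_nonneg _
    have e1 : I ^ (2 * s) = (I ^ s) ^ 2 := by
      rw [mul_comm, Real.rpow_mul hI0, Real.rpow_two]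
    have e2 : Real.exp (2 * σ * I) = Real.exp (σ * I) ^ 2 := by
      rw [← Real.exp_nat_mul]; congr 1; push_cast; ring
    rw [waveCoeff_wave, huv k hk, Complex.norm_real, Real.norm_eq_abs, e1, e2, ← mul_pow, ← mul_pow]
    refine pow_le_pow_left₀ (by positivity) ?_ 2
    have e3 : I ^ s * Real.exp (σ * I) ≤ s ^ s * expWeight b M hM k := by
      calc I ^ s * Real.exp (σ * I) ≤ s ^ s * Real.exp I * Real.exp (σ * I) :=
            mul_le_mul_of_nonneg_right (rpow_le_mul_exp hs hI0) (Real.exp_nonneg _)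
        _ = s ^ s * Real.exp ((σ + 1) * I) := by
            rw [mul_assoc, ← Real.exp_add]; congr 2; ring
        _ ≤ s ^ s * Real.exp (M * l1Norm k) := by
            refine mul_le_mul_of_nonneg_left (Real.exp_le_exp.2 ?_) (by positivity)
            calc (σ + 1) * I ≤ (σ + 1) * (((∑ j, ‖toVec (n j)‖) + 1) * l1Norm k) :=
                  mul_le_mul_of_nonneg_left (idxNorm_wave_le n k) (by positivity)
              _ = (σ + 1) * ((∑ j, ‖toVec (n j)‖) + 1) * l1Norm k := by ring
              _ ≤ M * l1Norm k := mul_le_mul_of_nonneg_right hM' (l1Norm_nonneg k)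
    calc |coeff v k| * I ^ s * Real.exp (σ * I) = |coeff v k| * (I ^ s * Real.exp (σ * I)) := by
          ring
      _ ≤ |coeff v k| * (s ^ s * expWeight b M hM k) := by gcongr
      _ = _ := by ring
  have hW : ∀ k, 0 ≤ expWeight b M hM k := fun k => (weight_pos _ k).le
  obtain ⟨h1, h2⟩ := summable_sq_and_sqrt_tsum_le ((hasSum_norm v).mul_left (s ^ s))
    (fun k => by have := hW k; positivity) (fun k => remainderTerm_nonneg n σ s _ (wave n k, k)) hbound
  refine ⟨((wave_graph_injective n).summable_iff hsupp).1 h1, ?_⟩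
  rwa [← (wave_graph_injective n).tsum_eq
    (Function.support_subset_iff'.2 hsupp)]

/-- The coefficients of the linear solution with amplitudes `a`. -/
def linearPart (W : Weight (Fin b → ℤ)) (a : Fin b → ℝ) : WeightedL1 W :=
  ∑ j, a j • X (Pi.single j 1)

theorem coeff_linearPart_single (a : Fin b → ℝ) (j : Fin b) :
    coeff (linearPart W a) (Pi.single j 1) = a j := by
  rw [linearPart, coeff_sum, Finset.sum_eq_single j]
  · rw [coeff_smul, coeff_X, if_pos rfl, mul_one]
  · intro i _ hi
    rw [coeff_smul, coeff_X, if_neg, mul_zero]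
    intro h
    have := congrFun h j
    rw [Pi.single_eq_same, Pi.single_eq_of_ne hi.symm] at this
    exact one_ne_zero this
  · simp

theorem coeff_linearPart_of_ne (a : Fin b → ℝ) {k : Fin b → ℤ} (hk : ∀ j, k ≠ Pi.single j 1) :
    coeff (linearPart W a) k = 0 := by
  rw [linearPart, coeff_sum]
  refine Finset.sum_eq_zero fun j _ => ?_
  rw [coeff_smul, coeff_X, if_neg (hk j), mul_zero]

/-- `e_j + e_p = e_l + e_m` holds exactly when the two pairs coincide up to order.
Inclusion-exclusion subtracts the overlap, where all four indices agree. -/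
theorem indicator_single_add_sub (j l m p : Fin b) :
    (if (Pi.single j 1 : Fin b → ℤ) = Pi.single l 1 + Pi.single m 1 + -Pi.single p 1
      then (1 : ℝ) else 0)
      = (if j = l then 1 else 0) * (if p = m then 1 else 0)
        + (if j = m then 1 else 0) * (if p = l then 1 else 0)
        - (if j = l then 1 else 0) * (if j = m then 1 else 0) * (if j = p then 1 else 0) := by
  have h : (Pi.single j 1 : Fin b → ℤ) = Pi.single l 1 + Pi.single m 1 + -Pi.single p 1 ↔
      (j = l ∧ p = m) ∨ (j = m ∧ p = l) := by
    rw [← sub_eq_add_neg, eq_sub_iff_add_eq,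
      Pi.single_add_single_eq_single_add_single one_ne_zero one_ne_zero]
    norm_num
  by_cases h1 : j = l <;> by_cases h2 : p = m <;> by_cases h3 : j = m <;> by_cases h4 : p = l <;>
    simp_all
  exact fun h => h4 h.symm

/-- The two pairings each contribute `a_j ∑ a_l²` and their overlap removes `a_j³`; doubling gives
the leading frequency shift. -/
theorem coeff_cubic_linearPart (a : Fin b → ℝ) (j : Fin b) :
    coeff ((2 : ℝ) • (linearPart W a ^ 2 * reflect W (linearPart W a))) (Pi.single j 1)
      = a j * (4 * ∑ l, a l ^ 2 - 2 * a j ^ 2) := by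
  have h1 : linearPart W a ^ 2 * reflect W (linearPart W a)
      = ∑ l, ∑ m, ∑ p, (a l * a m * a p) •
        X (W := W) (Pi.single l 1 + Pi.single m 1 + -Pi.single p 1) := by
    simp only [linearPart, pow_two, map_sum, map_smul, reflect_X, Finset.sum_mul,
      Finset.mul_sum, smul_mul_smul_comm, X_mul_X]
    rw [Finset.sum_comm_cycle]
    exact Finset.sum_congr rfl fun l _ => Finset.sum_comm
  have h2 : ∑ l, ∑ m, ∑ p, (a l * a m * a p) *
      ((if j = l then (1 : ℝ) else 0) * (if p = m then 1 else 0)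
        + (if j = m then 1 else 0) * (if p = l then 1 else 0)
        - (if j = l then 1 else 0) * (if j = m then 1 else 0) * (if j = p then 1 else 0))
      = 2 * (a j * ∑ l, a l ^ 2) - a j ^ 3 := by
    simp only [mul_sub, mul_add, Finset.sum_sub_distrib, Finset.sum_add_distrib]
    simp only [mul_ite, mul_one, mul_zero, Finset.sum_ite_eq, Finset.sum_ite_eq',
      Finset.mem_univ, if_true]
    simp [Finset.sum_ite_irrel, Finset.mul_sum, pow_two]
    ring_nf
    rw [Finset.sum_mul]
  rw [coeff_smul, h1]
  simp only [coeff_sum, coeff_smul, coeff_X, indicator_single_add_sub]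
  rw [h2]
  ring

theorem norm_linearPart_le {M : ℝ} (hM : 0 ≤ M) {a : Fin b → ℝ} {ε : ℝ}
    (ha : ∀ j, |a j| ≤ 2 * ε) :
    ‖linearPart (expWeight b M hM) a‖ ≤ b * (2 * Real.exp M) * ε := by
  have h : ∀ j ∈ Finset.univ, ‖a j • X (W := expWeight b M hM) (Pi.single j 1)‖
      ≤ 2 * ε * Real.exp M := fun j _ => by
    have hl : l1Norm (Pi.single j 1 : Fin b → ℤ) = 1 := by
      rw [l1Norm, Finset.sum_eq_single j]
      · simp
      · intro i _ hi
        simp [Pi.single_eq_of_ne hi]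
      · simp
    have hw : expWeight b M hM (Pi.single j 1) = Real.exp M := by
      change Real.exp (M * _) = _
      rw [hl, mul_one]
    rw [norm_smul, norm_X, hw, Real.norm_eq_abs]
    exact mul_le_mul_of_nonneg_right (ha j) (Real.exp_nonneg _)
  refine (norm_sum_le_of_le _ h).trans_eq ?_
  rw [Finset.sum_const, Finset.card_univ, Fintype.card_fin, nsmul_eq_mul]
  ring

end Coefficients

theorem norm_le_sum_abs {b : ℕ} (x : EuclideanSpace ℝ (Fin b)) : ‖x‖ ≤ ∑ j, |x j| := by
  rw [EuclideanSpace.norm_eq]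
  refine Real.sqrt_le_iff.2 ⟨Finset.sum_nonneg fun _ _ => abs_nonneg _, ?_⟩
  exact Finset.sum_sq_le_sq_sum_of_nonneg fun _ _ => abs_nonneg _

end QuasilinearNLS

end

/-! ### Proof of the persistence theorem. -/

open QuasilinearNLS QuasilinearNLS.WeightedL1

theorem theorem1p1 {b d : ℕ} (hb : 1 ≤ b) (hbd : b ≤ d)
    (α : ℕ → ℕ → ℝ) (hα : QuasilinearNLS.IsAdmissible α)
    (ρ γ τ : ℝ) (hγ : 0 < γ) (hτ : 1 < τ) (hρ : QuasilinearNLS.IsDiophantine ρ γ τ)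
    (n : Fin b → Fin d → ℤ)
    (hn : LinearIndependent ℝ (fun j => QuasilinearNLS.toVec (n j)))
    (hK : QuasilinearNLS.nontrivialResonantModes n = ∅) :
    ∃ κ : ℝ, 0 < κ ∧ ∀ σ s : ℝ, 0 < σ → (b : ℝ) / 2 < s →
      ∃ C ε₀ : ℝ, 0 < C ∧ 0 < ε₀ ∧
        ∀ ε : ℝ, 0 < ε → ε < ε₀ →
          ∀ a : EuclideanSpace ℝ (Fin b), (∀ j, a j ∈ Set.Icc ε (2 * ε)) →
            ∃ ω : EuclideanSpace ℝ (Fin b),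
              QuasilinearNLS.PersistsWith α ρ n κ σ s C a ω ∧
              ∀ j, |ω j - ((QuasilinearNLS.sqNorm (n j) : ℝ) + ρ
                  - (QuasilinearNLS.sqNorm (n j) : ℝ)
                    * (4 * ∑ l, a l ^ 2 - 2 * a j ^ 2))| ≤ C * ‖a‖ ^ 3 := by
  -- The correction is `O(ε³)`, so any `κ < 2` would serve.
  refine ⟨1, one_pos, fun σ s hσ hs' => ?_⟩
  have hs : 0 < s := lt_of_le_of_lt (by positivity) hs'
  obtain ⟨C₀, hC₀, hm₀, hm⟩ := exists_bound_div_divisor hn ρ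
  obtain ⟨R, hR, hcR⟩ := hα.analytic
  have hr : 0 < R / 4 := by positivity
  have hc : ConvergesOn α (4 * (R / 4)) := by rwa [mul_div_cancel₀ R four_ne_zero]
  have hA0 : 0 ≤ ∑ j, ‖toVec (n j)‖ := Finset.sum_nonneg fun _ _ => norm_nonneg _
  -- The product controls the remainder norm; the added `2` provides two derivatives.
  set M : ℝ := (σ + 1) * ((∑ j, ‖toVec (n j)‖) + 1) + 2 with hMdef
  have hM2 : 2 ≤ M := by
    have : 0 ≤ (σ + 1) * ((∑ j, ‖toVec (n j)‖) + 1) := by positivity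
    linarith
  have hM : 0 ≤ M := by linarith
  set W := expWeight b M hM
  set S : ℝ := ∑ j, (sqNorm (n j) : ℝ) with hS
  have hsq0 : ∀ j, 0 ≤ (sqNorm (n j) : ℝ) := fun j => by
    rw [sqNorm_eq_norm_sq]; positivity
  have hS0 : 0 ≤ S := Finset.sum_nonneg fun j _ => hsq0 j
  have hsqS : ∀ j, (sqNorm (n j) : ℝ) ≤ S := fun j =>
    Finset.single_le_sum (f := fun j => (sqNorm (n j) : ℝ)) (fun j _ => hsq0 j) (Finset.mem_univ j)
  obtain ⟨K, ε₁, hK0, hε₁, hsol⟩ := exists_small_solution (ι := Fin b) hα hr hc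
    (J := reflect W) norm_reflect_le
    (M₀ := multiplier W _ C₀ hm₀) (M := fun j => multiplier W _ C₀ (hm j))
    (φ := fun j => coeffL W (Pi.single j 1)) (C₁ := S) (B₀ := b * (2 * Real.exp M))
    hC₀.le hS0 (by positivity) (norm_multiplier_le hC₀.le hm₀)
    (fun j => norm_multiplier_le hC₀.le (hm j)) (fun j x => abs_coeff_le x _)
  -- Summing the shifts uses `b * (S * K)`, the frequency expansion one further `S * K`, and the
  -- final `1` gives positivity. The second threshold turns `s ^ s * K * ε ^ 3` into something below
  -- `ε ^ 2`.
  refine ⟨(b + 1) * (S * K) + 1, min ε₁ (1 / (s ^ s * K)), by positivity, by positivity,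
    fun ε hε hlt a ha => ?_⟩
  obtain ⟨hlt1, hlt2⟩ := lt_min_iff.1 hlt
  have ha0 : ∀ j, 0 < a j := fun j => hε.trans_le (ha j).1
  have hεa : ε ≤ ‖a‖ := by
    refine (ha ⟨0, hb⟩).1.trans ?_
    exact (le_abs_self _).trans (PiLp.norm_apply_le a _)
  obtain ⟨v, hfix, hv, hur, hF, hF'⟩ := hsol ε hε hlt1 (linearPart W a)
    (fun j => (sqNorm (n j) : ℝ) / a j)
    (norm_linearPart_le hM fun j => by rw [abs_of_pos (ha0 j)]; exact (ha j).2)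
    (fun j => by
      rw [abs_div, abs_of_nonneg (hsq0 j), abs_of_pos (ha0 j)]
      exact div_le_div₀ hS0 (hsqS j) hε (ha j).1)
  set u := linearPart W a + v with hu
  set F := nonlinearity α (reflect W) u with hFdef
  -- The shift forced by the equation at `e_j`, where the divisor vanishes and `u` has coefficient
  -- `a j`.
  set δ : Fin b → ℝ := fun j => -((sqNorm (n j) : ℝ) / a j * coeff F (Pi.single j 1)) with hδ
  have hcoef : ∀ k, coeff v k = sqNorm (wave n k) / divisor n ρ k * coeff F k
      + ∑ j, δ j * ((k j : ℝ) / divisor n ρ k * coeff v k) := fun k => by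
    conv_lhs => rw [← hfix]
    rw [coeff_sub, sub_eq_add_neg]
    simp only [coeff_sum, coeff_smul, coeff_multiplier, coeffL_apply, hδ, neg_mul,
      Finset.sum_neg_distrib]
  -- Since the divisor is zero at `e_j`, division by zero makes every multiplier vanish there, so
  -- the normalisation of the amplitudes is automatic.
  have hve : ∀ j, coeff v (Pi.single j 1) = 0 := fun j => by
    rw [hcoef, divisor_single]
    simp
  have hue : ∀ j, coeff u (Pi.single j 1) = a j := fun j => by
    rw [hu, coeff_add, hve, add_zero, coeff_linearPart_single]
  have huv : ∀ k, (∀ j, k ≠ Pi.single j 1) → coeff u k = coeff v k := fun k hk => by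
    rw [hu, coeff_add, coeff_linearPart_of_ne _ hk, zero_add]
  set ω : EuclideanSpace ℝ (Fin b) := WithLp.toLp 2 fun j => (sqNorm (n j) : ℝ) + ρ + δ j with hω
  have hωj : ∀ j, ω j = (sqNorm (n j) : ℝ) + ρ + δ j := fun j => rfl
  have hdiv : ∀ k : Fin b → ℤ, sqNorm (wave n k) + ρ - ∑ j, (k j : ℝ) * ω j
      = divisor n ρ k - ∑ j, δ j * (k j : ℝ) := fun k => by
    simp only [hωj, divisor, mul_add, Finset.sum_add_distrib, mul_comm (δ _)]
    ring
  have heq : ∀ k, (sqNorm (wave n k) + ρ - ∑ j, (k j : ℝ) * ω j) * coeff u k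
      = sqNorm (wave n k) * coeff F k := fun k => by
    rw [hdiv]
    by_cases hk : ∃ j, k = Pi.single j 1
    · obtain ⟨j, rfl⟩ := hk
      have hsum : ∑ i, δ i * ((Pi.single j 1 : Fin b → ℤ) i : ℝ) = δ j := by
        rw [Finset.sum_eq_single j]
        · simp
        · intro i _ hi
          simp [Pi.single_eq_of_ne hi]
        · simp
      rw [hue, divisor_single, wave_single, hsum, hδ]
      have := (ha0 j).ne'
      field_simp
      ring
    · push Not at hk
      have hD : divisor n ρ k ≠ 0 := divisor_ne_zero hγ hρ hK hk
      have h1 := congrArg (divisor n ρ k * ·) (hcoef k)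
      have h2 : divisor n ρ k * ∑ j, δ j * ((k j : ℝ) / divisor n ρ k * coeff v k)
          = (∑ j, δ j * (k j : ℝ)) * coeff v k := by
        rw [Finset.mul_sum, Finset.sum_mul]
        refine Finset.sum_congr rfl fun j _ => ?_
        field_simp
      have h3 : divisor n ρ k * (sqNorm (wave n k) / divisor n ρ k * coeff F k)
          = sqNorm (wave n k) * coeff F k := by field_simp
      simp only [mul_add, h2, h3] at h1
      rw [huv k hk]
      linear_combination h1
  have hδle : ∀ j, |δ j| ≤ S * K * ε ^ 2 := fun j => by
    rw [hδ, abs_neg, abs_mul, abs_div, abs_of_nonneg (hsq0 j), abs_of_pos (ha0 j)]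
    calc _ ≤ S / ε * (K * ε ^ 3) :=
          mul_le_mul (div_le_div₀ hS0 (hsqS j) hε (ha j).1) ((abs_coeff_le F _).trans hF)
            (abs_nonneg _) (by positivity)
      _ = _ := by field_simp
  have hSK : 0 ≤ S * K := by positivity
  refine ⟨ω, ⟨synth ω n u, waveCoeff n u, isSolution_synth ω n hα hr hc hM2 hur heq,
    hasSum_waveCoeff n ω u, fun j => ?_, ?_⟩, fun j => ?_⟩
  · have := waveCoeff_wave n u (Pi.single j 1)
    rw [wave_single] at this
    rw [this, hue]
  · obtain ⟨h1, h2⟩ := remainder_bound n hσ hs hM (by linarith) huv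
    refine ⟨h1, h2.trans_lt ?_, ?_⟩
    · have hs0 : 0 < s ^ s := Real.rpow_pos_of_pos hs s
      rw [lt_div_iff₀ (by positivity)] at hlt2
      rw [show (1 : ℝ) + 1 = 2 by norm_num, Real.rpow_two]
      calc s ^ s * ‖v‖ ≤ s ^ s * (K * ε ^ 3) := by gcongr
        _ = ε * (s ^ s * K) * ε ^ 2 := by ring
        _ < 1 * ε ^ 2 := by gcongr
        _ ≤ ‖a‖ ^ 2 := by rw [one_mul]; gcongr
    · refine (norm_le_sum_abs _).trans ?_
      have hj : ∀ j, (ω - linearFrequency n ρ) j = δ j := fun j => by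
        change ω j - ((sqNorm (n j) : ℝ) + ρ) = δ j
        rw [hωj]; ring
      simp only [hj]
      calc ∑ j, |δ j| ≤ ∑ _j : Fin b, S * K * ε ^ 2 := Finset.sum_le_sum fun j _ => hδle j
        _ = b * (S * K) * ε ^ 2 := by
          rw [Finset.sum_const, Finset.card_univ, Fintype.card_fin, nsmul_eq_mul]; ring
        _ ≤ ((b + 1) * (S * K) + 1) * ‖a‖ ^ 2 := by
          gcongr
          linarith
  -- Dividing this quartic error by `a j ≥ ε` leaves the cubic error in the frequency.
  · have h1 : |coeff F (Pi.single j 1) - a j * (4 * ∑ l, a l ^ 2 - 2 * a j ^ 2)| ≤ K * ε ^ 4 := by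
      rw [← coeff_cubic_linearPart (W := W), ← coeff_sub]
      exact (abs_coeff_le _ _).trans hF'
    have h2 : ω j - ((sqNorm (n j) : ℝ) + ρ - (sqNorm (n j) : ℝ)
        * (4 * ∑ l, a l ^ 2 - 2 * a j ^ 2))
        = -((sqNorm (n j) : ℝ) / a j
          * (coeff F (Pi.single j 1) - a j * (4 * ∑ l, a l ^ 2 - 2 * a j ^ 2))) := by
      rw [hωj, hδ]
      have := (ha0 j).ne'
      field_simp
      ring
    rw [h2, abs_neg, abs_mul, abs_div, abs_of_nonneg (hsq0 j), abs_of_pos (ha0 j)]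
    calc _ ≤ S / ε * (K * ε ^ 4) :=
          mul_le_mul (div_le_div₀ hS0 (hsqS j) hε (ha j).1) h1 (abs_nonneg _) (by positivity)
      _ = S * K * ε ^ 3 := by field_simp
      _ ≤ ((b + 1) * (S * K) + 1) * ‖a‖ ^ 3 := by
          gcongr
          have : 0 ≤ (b : ℝ) * (S * K) := by positivity
          linarith
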